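/- **Computational model.** A word RAM with word length $w$ that, besides words (integers in $\{0,\dots,2^w-1\}$ with the usual arithmetic, bitwise, shift and comparison operations), stores complex numbers in random-access memory. Each word operation, each memory access, and each exact operation $+,-,\times,/$ or zero test on complex numbers costs one step; words can be converted to numbers, but not conversely. **Definitions.** A graph $G=(V,E)$ is a finite undirected graph, loops and parallel edges allowed, with $n=|V|$ and $m=|E|$. For $A\subseteq E$ let $k(A)$ be the number of connected components of $(V,A)$, and let $$T(G;x,y)=\sum_{A\subseteq E}(x-1)^{k(A)-k(E)}(y-1)^{k(A)+|A|-|V|}.$$ Let $H_2=\{(x,y)\in\mathbb C^2:(x-1)(y-1)=2\}$. A tree decomposition of $G$ consists of a tree $\mathbb T$ and bags $B_x\subseteq V$ ($x\in V(\mathbb T)$) such that every vertex lies in some bag, both ends of every edge lie in a common bag, and for every $v\in V$ the set $\{x: v\in B_x\}$ induces a (nonempty) subtree of $\mathbb T$. Its width is $\max_x|B_x|-1$ (read as $0$ if $n=0$). **Theorem.** There are a single program and constants $C,d\in\mathbb N$ such that the following holds. Let the input consist of a graph $G$ with $n$ vertices and $m$ edges (as an edge list), a tree decomposition of $G$ with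 $t$ nodes and of width $\mathrm{tw}$ (as the adjacency matrix of the tree and the membership matrix of the bags), and a point $(a,b)\in H_2$. Then, on every machine whose word length $w$ satisfies $2^w\ge C\cdot 2^{\mathrm{tw}}(n+m+t)^d$, the program halts within $$C\cdot 2^{\mathrm{tw}}\,(n+m+t)^d$$ steps and outputs $T(G;a,b)$. In particular, for graphs with $m\le n^{O(1)}$ (such as simple graphs) and decompositions with $t\le n^{O(1)}$ nodes, the running time is $2^{\mathrm{tw}}n^{O(1)}$. -/

import Mathlib

namespace TutteRAM

/-! ### Graphs, the Tutte polynomial, tree decompositions -/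

/-- A finite undirected multigraph with vertex set `Fin n` and edge set `Fin m`, given by its edge
list. Loops and parallel edges are allowed; the order of the two ends of an edge carries no
meaning. -/
structure Multigraph (n m : ℕ) where
  ends : Fin m → Fin n × Fin n

/-- The simple graph on the vertex set in which two distinct vertices are adjacent when some edge
of `A` joins them. It has the same connected components as the graph `(V, A)`. -/
def Multigraph.spanning {n m : ℕ} (G : Multigraph n m) (A : Finset (Fin m)) :
    SimpleGraph (Fin n) :=
  SimpleGraph.fromRel fun u v => ∃ e ∈ A, G.ends e = (u, v)

/-- `k(A)`: the number of connected components of `(V, A)`. -/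
noncomputable def Multigraph.numComp {n m : ℕ} (G : Multigraph n m) (A : Finset (Fin m)) : ℕ :=
  Nat.card (G.spanning A).ConnectedComponent

/-- The value `T(G; x, y) = ∑_{A ⊆ E} (x - 1)^(k(A) - k(E)) (y - 1)^(k(A) + |A| - |V|)`.
Both exponents are nonnegative integers for every `A`, so the subtractions are exact. -/
noncomputable def Multigraph.tutte {n m : ℕ} (G : Multigraph n m) (x y : ℂ) : ℂ :=
  ∑ A : Finset (Fin m),
    (x - 1) ^ (G.numComp A - G.numComp Finset.univ) * (y - 1) ^ (G.numComp A + A.card - n)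

/-- The curve `H_α = {(x, y) : (x - 1)(y - 1) = α}`. -/
def hyperbola (α : ℂ) : Set (ℂ × ℂ) := {p | (p.1 - 1) * (p.2 - 1) = α}

/-- A tree decomposition of `G` whose tree has the `t` nodes `Fin t`. -/
structure TreeDecomposition {n m : ℕ} (G : Multigraph n m) (t : ℕ) where
  tree : SimpleGraph (Fin t)
  isTree : tree.IsTree
  bag : Fin t → Finset (Fin n)
  vertex_mem : ∀ v, ∃ x, v ∈ bag x
  edge_mem : ∀ e, ∃ x, (G.ends e).1 ∈ bag x ∧ (G.ends e).2 ∈ bag x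
  subtree : ∀ v, (tree.induce {x | v ∈ bag x}).Connected

/-- The width `max_x |B_x| - 1` (read as `0` when all bags are empty, which forces `n = 0`). -/
def TreeDecomposition.width {n m t : ℕ} {G : Multigraph n m} (D : TreeDecomposition G t) : ℕ :=
  (Finset.univ.sup fun x => (D.bag x).card) - 1

/-! ### The word RAM with unit-cost arithmetic on numbers

Memory consists of word registers, word arrays and number arrays. Words are the integers
`0, …, 2 ^ w - 1`, numbers are complex numbers. A program is a finite text, so it names only
finitely many registers and arrays; array cells are addressed by computed words. There is a
conversion of words to numbers but none of numbers to words: numbers can only be combined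
by the four arithmetic operations and compared with zero. -/

/-- Memory contents: `reg r` is the word register `r`, `word k i` is cell `i` of the word array
`k`, `num k i` is cell `i` of the number array `k`. -/
structure Store where
  reg : ℕ → ℕ
  word : ℕ → ℕ → ℕ
  num : ℕ → ℕ → ℂ

/-- Operations on words. -/
inductive WordOp
  | add | sub | mul | div | mod | and | or | xor | shl | shr | eq | lt

/-- Operations on words of length `w`. Results are reduced modulo `2 ^ w`; `sub` is truncated at
`0`; comparisons return `1` or `0`; division by `0` gives `0`. -/
def WordOp.eval (w : ℕ) (o : WordOp) (x y : ℕ) : ℕ :=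
  (match o with
    | .add => x + y
    | .sub => x - y
    | .mul => x * y
    | .div => x / y
    | .mod => x % y
    | .and => x &&& y
    | .or => x ||| y
    | .xor => x ^^^ y
    | .shl => x <<< y
    | .shr => x >>> y
    | .eq => if x = y then 1 else 0
    | .lt => if x < y then 1 else 0) % 2 ^ w

/-- Word expressions: constants, registers, array cells, operations. -/
inductive WordExpr
  | const (c : ℕ)
  | reg (r : ℕ)
  | load (k : ℕ) (addr : WordExpr)
  | op (o : WordOp) (e₁ e₂ : WordExpr)

/-- The value of a word expression. -/
def WordExpr.eval (w : ℕ) (s : Store) : WordExpr → ℕ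
  | .const c => c % 2 ^ w
  | .reg r => s.reg r
  | .load k e => s.word k (e.eval w s)
  | .op o e₁ e₂ => o.eval w (e₁.eval w s) (e₂.eval w s)

/-- The number of steps for evaluating a word expression: one per constant, register access,
memory access and operation. -/
def WordExpr.cost : WordExpr → ℕ
  | .const _ => 1
  | .reg _ => 1
  | .load _ e => e.cost + 1
  | .op _ e₁ e₂ => e₁.cost + e₂.cost + 1

/-- Arithmetic operations on numbers. -/
inductive NumOp
  | add | sub | mul | div

/-- Exact arithmetic on numbers (with `x / 0 = 0`). -/
noncomputable def NumOp.eval (o : NumOp) (x y : ℂ) : ℂ :=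
  match o with
  | .add => x + y
  | .sub => x - y
  | .mul => x * y
  | .div => x / y

/-- Number expressions: words read as numbers, array cells, operations. -/
inductive NumExpr
  | ofWord (e : WordExpr)
  | load (k : ℕ) (addr : WordExpr)
  | op (o : NumOp) (f₁ f₂ : NumExpr)

/-- The value of a number expression. -/
noncomputable def NumExpr.eval (w : ℕ) (s : Store) : NumExpr → ℂ
  | .ofWord e => (e.eval w s : ℂ)
  | .load k e => s.num k (e.eval w s)
  | .op o f₁ f₂ => o.eval (f₁.eval w s) (f₂.eval w s)

/-- The number of steps for evaluating a number expression. -/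
def NumExpr.cost : NumExpr → ℕ
  | .ofWord e => e.cost + 1
  | .load _ e => e.cost + 1
  | .op _ f₁ f₂ => f₁.cost + f₂.cost + 1

/-- Programs. -/
inductive Program
  | skip
  /-- `reg r := e` -/
  | setReg (r : ℕ) (e : WordExpr)
  /-- `word k addr := e` -/
  | setWord (k : ℕ) (addr e : WordExpr)
  /-- `num k addr := f` -/
  | setNum (k : ℕ) (addr : WordExpr) (f : NumExpr)
  /-- `reg r := 1` if `f = 0`, and `reg r := 0` otherwise -/
  | testZero (r : ℕ) (f : NumExpr)
  | seq (p q : Program)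
  /-- run `p` if `e ≠ 0`, and `q` otherwise -/
  | ite (e : WordExpr) (p q : Program)
  /-- run `p` as long as `e ≠ 0` -/
  | loop (e : WordExpr) (p : Program)

/-- Write a word to a register. -/
def Store.setReg (s : Store) (r x : ℕ) : Store :=
  { s with reg := Function.update s.reg r x }

/-- Write a word to cell `i` of the word array `k`. -/
def Store.setWord (s : Store) (k i x : ℕ) : Store :=
  { s with word := Function.update s.word k (Function.update (s.word k) i x) }

/-- Write a number to cell `i` of the number array `k`. -/
noncomputable def Store.setNum (s : Store) (k i : ℕ) (z : ℂ) : Store :=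
  { s with num := Function.update s.num k (Function.update (s.num k) i z) }

open Classical in
/-- `Exec w p s T s'`: on a machine with words of length `w`, the program `p` started on the
memory `s` halts after exactly `T` steps with the memory `s'`. -/
inductive Exec (w : ℕ) : Program → Store → ℕ → Store → Prop
  | skip (s : Store) : Exec w .skip s 1 s
  | setReg (s : Store) (r : ℕ) (e : WordExpr) :
      Exec w (.setReg r e) s (e.cost + 1) (s.setReg r (e.eval w s))
  | setWord (s : Store) (k : ℕ) (a e : WordExpr) :
      Exec w (.setWord k a e) s (a.cost + e.cost + 1) (s.setWord k (a.eval w s) (e.eval w s))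
  | setNum (s : Store) (k : ℕ) (a : WordExpr) (f : NumExpr) :
      Exec w (.setNum k a f) s (a.cost + f.cost + 1) (s.setNum k (a.eval w s) (f.eval w s))
  | testZero (s : Store) (r : ℕ) (f : NumExpr) :
      Exec w (.testZero r f) s (f.cost + 1)
        (s.setReg r ((if f.eval w s = 0 then 1 else 0) % 2 ^ w))
  | seq {p q : Program} {s s' s'' : Store} {T T' : ℕ}
      (hp : Exec w p s T s') (hq : Exec w q s' T' s'') : Exec w (.seq p q) s (T + T') s''
  | iteTrue {e : WordExpr} {p q : Program} {s s' : Store} {T : ℕ}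
      (he : e.eval w s ≠ 0) (hp : Exec w p s T s') : Exec w (.ite e p q) s (e.cost + 1 + T) s'
  | iteFalse {e : WordExpr} {p q : Program} {s s' : Store} {T : ℕ}
      (he : e.eval w s = 0) (hq : Exec w q s T s') : Exec w (.ite e p q) s (e.cost + 1 + T) s'
  | loopStop {e : WordExpr} {p : Program} {s : Store}
      (he : e.eval w s = 0) : Exec w (.loop e p) s (e.cost + 1) s
  | loopStep {e : WordExpr} {p : Program} {s s' s'' : Store} {T T' : ℕ}
      (he : e.eval w s ≠ 0) (hp : Exec w p s T s') (hl : Exec w (.loop e p) s' T' s'') :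
      Exec w (.loop e p) s (e.cost + 1 + T + T') s''

open Classical in
/-- The initial memory for the input `(G, D, a, b)`.
Registers `0, 1, 2` hold `n`, `m`, `t`.
Word arrays `0` and `1` hold the first and the second end of each edge.
Word array `2` holds the `t × t` adjacency matrix of the tree, row by row.
Word array `3` holds the `t × n` membership matrix of the bags, row by row.
Number array `0` holds `a` and `b`. Everything else is `0`. -/
noncomputable def input {n m t : ℕ} (G : Multigraph n m) (D : TreeDecomposition G t) (a b : ℂ) :
    Store where
  reg r := if r = 0 then n else if r = 1 then m else if r = 2 then t else 0
  word k i :=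
    if k = 0 then (if h : i < m then ((G.ends ⟨i, h⟩).1 : ℕ) else 0)
    else if k = 1 then (if h : i < m then ((G.ends ⟨i, h⟩).2 : ℕ) else 0)
    else if k = 2 then
      (if ∃ x y : Fin t, i = x * t + y ∧ D.tree.Adj x y then 1 else 0)
    else if k = 3 then
      (if ∃ (x : Fin t) (v : Fin n), i = x * n + v ∧ v ∈ D.bag x then 1 else 0)
    else 0
  num k i := if k = 0 then (if i = 0 then a else if i = 1 then b else 0) else 0

/-- The output: cell `0` of number array `1`. -/
def Store.output (s : Store) : ℂ := s.num 1 0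

end TutteRAM

namespace TutteRAM

/-! ### The Tutte polynomial on `H₂` and two-colourings -/

section Colourings
open Finset

variable {n m : ℕ}

/-! On `(a-1)(b-1) = 2` one has `(a-1)^k(A) (b-1)^(k(A)+|A|) = 2^k(A) (b-1)^|A|`, and `2^k(A)`
counts the two-colourings of the vertices that are constant along the edges of `A`. Summing over `A`
for a fixed colouring gives a factor `b` for each monochromatic edge and `1` for any other edge. So
`T(G;a,b) (a-1)^k(E) (b-1)^n` is an Ising partition function (`Multigraph.tutte_mul`), and it
determines `T` because `a-1` and `b-1` are nonzero.

The partition function is a sum over vertex subsets of a product of tables, one per node, each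
depending only on the trace of the subset on the bag. A leaf `x` with neighbour `p` can be summed
out: by the subtree property its bag meets the other remaining bags only inside the bag of `p`, so
the result is a factor for the table of `p` (`tableSum_erase`). Subsets of a bag are numbered in
binary, so a table has at most `2^(tw+1)` entries. The message from `x` to `p` is scattered once and
looked up once, which costs the sum of the two table sizes and not their product. Repeated passes
over the nodes remove leaves until one table is left (`BagData.runs_round`, `BagData.runs_rounds`).

The final division needs `k(E)`. The same program with weights `1` and `0` yields `2^k(E)`, but as a
complex number, which cannot become a word. `BagData.runs_divide` halves it until it equals `1` and
divides by `a-1` at each halving.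

Correctness and running time are proved together through the predicate `Runs`; the bound on the word
length serves to exclude overflow. -/

theorem Multigraph.constant_iff_reachable (G : Multigraph n m) (A : Finset (Fin m))
    {β : Type*} (σ : Fin n → β) :
    (∀ e ∈ A, σ (G.ends e).1 = σ (G.ends e).2) ↔
      ∀ u v, (G.spanning A).Reachable u v → σ u = σ v := by
  constructor
  · intro h u v huv
    obtain ⟨p⟩ := huv
    induction p with
    | nil => rfl
    | cons hadj _ ih =>
      refine Eq.trans ?_ ih
      rw [Multigraph.spanning, SimpleGraph.fromRel_adj] at hadj
      rcases hadj.2 with ⟨e, he, hh⟩ | ⟨e, he, hh⟩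
      · have := h e he; rw [hh] at this; exact this
      · have := h e he; rw [hh] at this; exact this.symm
  · intro h e he
    by_cases huv : (G.ends e).1 = (G.ends e).2
    · rw [huv]
    · refine h _ _ (SimpleGraph.Adj.reachable ?_)
      rw [Multigraph.spanning, SimpleGraph.fromRel_adj]
      exact ⟨huv, Or.inl ⟨e, he, rfl⟩⟩

/-- Functions that are constant along the edges of `A` are functions on the components. -/
def Multigraph.constantEquiv (G : Multigraph n m) (A : Finset (Fin m)) (β : Type*) :
    {σ : Fin n → β // ∀ e ∈ A, σ (G.ends e).1 = σ (G.ends e).2} ≃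
      ((G.spanning A).ConnectedComponent → β) where
  toFun σ := Quot.lift σ.1 ((G.constant_iff_reachable A σ.1).1 σ.2)
  invFun f := ⟨fun v => f ((G.spanning A).connectedComponentMk v),
    (G.constant_iff_reachable A _).2 fun _ _ h =>
      congrArg f (SimpleGraph.ConnectedComponent.eq.2 h)⟩
  left_inv σ := rfl
  right_inv f := by
    funext c
    induction c using SimpleGraph.ConnectedComponent.ind with
    | _ v => rfl

theorem Multigraph.card_constant (G : Multigraph n m) (A : Finset (Fin m)) (β : Type*) [Fintype β]
    [DecidableEq β] :
    Fintype.card {σ : Fin n → β // ∀ e ∈ A, σ (G.ends e).1 = σ (G.ends e).2} =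
      Fintype.card β ^ G.numComp A := by
  rw [← Nat.card_eq_fintype_card, Nat.card_congr (G.constantEquiv A β), Nat.card_fun,
    Nat.card_eq_fintype_card]
  rfl

theorem Multigraph.numComp_anti (G : Multigraph n m) {A B : Finset (Fin m)} (h : A ⊆ B) :
    G.numComp B ≤ G.numComp A := by
  refine SimpleGraph.ConnectedComponent.card_le_card_of_le fun u v huv => ?_
  rw [Multigraph.spanning, SimpleGraph.fromRel_adj] at huv ⊢
  refine ⟨huv.1, huv.2.imp ?_ ?_⟩ <;> exact fun ⟨e, he, hh⟩ => ⟨e, h he, hh⟩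

/-- Rank-nullity over the field with two elements, by counting: the coboundary map from vertex
functions to functions on `A` has a kernel of size `2^k(A)` and a range of size at most `2^|A|`. It
makes the exponent `k(A) + |A| - n` free of truncation. -/
theorem Multigraph.card_le_numComp_add_card (G : Multigraph n m) (A : Finset (Fin m)) :
    n ≤ G.numComp A + A.card := by
  let f : (Fin n → ZMod 2) →+ (A → ZMod 2) :=
    { toFun := fun σ e => σ (G.ends e).1 - σ (G.ends e).2
      map_zero' := by ext; simp
      map_add' := by intro x y; ext e; simp only [Pi.add_apply]; ring }
  have hker : Nat.card f.ker = 2 ^ G.numComp A := by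
    have := G.card_constant A (ZMod 2)
    rw [ZMod.card] at this
    rw [← this, ← Nat.card_eq_fintype_card]
    refine Nat.card_congr (Equiv.subtypeEquivRight fun σ => ?_)
    rw [AddMonoidHom.mem_ker, funext_iff]
    simp [f, sub_eq_zero]
  have hrange : Nat.card f.range ≤ 2 ^ A.card := by
    refine (Nat.card_le_card_of_injective _ (Subtype.val_injective)).trans ?_
    simp [Nat.card_eq_fintype_card, ZMod.card]
  have hmul : Nat.card f.ker * Nat.card f.range = 2 ^ n := by
    rw [mul_comm, ← Nat.card_congr (QuotientAddGroup.quotientKerEquivRange f).toEquiv,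
      ← AddSubgroup.card_eq_card_quotient_mul_card_addSubgroup]
    simp [Nat.card_eq_fintype_card, ZMod.card]
  refine (Nat.pow_le_pow_iff_right (a := 2) (by norm_num)).1 ?_
  rw [pow_add, ← hmul, hker]
  exact Nat.mul_le_mul_left _ hrange

theorem Multigraph.numComp_le (G : Multigraph n m) (A : Finset (Fin m)) : G.numComp A ≤ n := by
  have := Nat.card_le_card_of_surjective (G.spanning A).connectedComponentMk
    fun c => c.exists_rep
  simpa [Multigraph.numComp] using this

/-- The partition function of the two-colourings in which a monochromatic edge has weight `p` and
any other edge has weight `q`. -/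
noncomputable def Multigraph.ising (G : Multigraph n m) (p q : ℂ) : ℂ :=
  ∑ σ : Fin n → Bool, ∏ e, if σ (G.ends e).1 = σ (G.ends e).2 then p else q

theorem Multigraph.sum_constant (G : Multigraph n m) (A : Finset (Fin m)) :
    (∑ σ : Fin n → Bool, ∏ e ∈ A, if σ (G.ends e).1 = σ (G.ends e).2 then (1 : ℂ) else 0) =
      2 ^ G.numComp A := by
  have h := G.card_constant A Bool
  rw [Fintype.card_bool, Fintype.card_subtype] at h
  rw [← Nat.cast_ofNat, ← Nat.cast_pow, ← h, Finset.card_filter, Nat.cast_sum]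
  refine Finset.sum_congr rfl fun σ _ => ?_
  rw [Finset.prod_ite_zero]
  simp

/-- This lets the algorithm for the partition function also deliver the number of components. -/
theorem Multigraph.ising_one_zero (G : Multigraph n m) :
    G.ising 1 0 = 2 ^ G.numComp Finset.univ :=
  G.sum_constant Finset.univ

/-- The Fortuin–Kasteleyn expansion: write each edge factor as `1 + (b - 1) * [monochromatic]`,
multiply out over edge sets, and exchange the two sums. -/
theorem Multigraph.ising_one (G : Multigraph n m) (b : ℂ) :
    G.ising b 1 = ∑ A : Finset (Fin m), 2 ^ G.numComp A * (b - 1) ^ A.card := by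
  have h : ∀ σ : Fin n → Bool,
      (∏ e, if σ (G.ends e).1 = σ (G.ends e).2 then b else 1) =
        ∑ A : Finset (Fin m), (b - 1) ^ A.card *
          ∏ e ∈ A, if σ (G.ends e).1 = σ (G.ends e).2 then (1 : ℂ) else 0 := by
    intro σ
    have : ∀ e, (if σ (G.ends e).1 = σ (G.ends e).2 then b else 1) =
        (b - 1) * (if σ (G.ends e).1 = σ (G.ends e).2 then 1 else 0) + 1 := by
      intro e; split_ifs <;> ring
    simp_rw [this, Finset.prod_add_one, Finset.prod_mul_distrib, Finset.prod_const]
    simp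
  unfold Multigraph.ising
  simp_rw [h]
  rw [Finset.sum_comm]
  refine Finset.sum_congr rfl fun A _ => ?_
  rw [← Finset.mul_sum, G.sum_constant, mul_comm]

/-- The extra factors complete the exponents to `k(A)` and `k(A) + |A|`; then `(a-1)(b-1) = 2` turns
the `k(A)`-th powers into `2^k(A)`, termwise in `A`. -/
theorem Multigraph.tutte_mul (G : Multigraph n m) {a b : ℂ} (h : (a - 1) * (b - 1) = 2) :
    G.tutte a b * ((a - 1) ^ G.numComp Finset.univ * (b - 1) ^ n) = G.ising b 1 := by
  rw [G.ising_one, Multigraph.tutte, Finset.sum_mul]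
  refine Finset.sum_congr rfl fun A _ => ?_
  have h1 := G.numComp_anti (Finset.subset_univ A)
  have h2 := G.card_le_numComp_add_card A
  calc _ = ((a - 1) ^ (G.numComp A - G.numComp Finset.univ) * (a - 1) ^ G.numComp Finset.univ) *
        ((b - 1) ^ (G.numComp A + A.card - n) * (b - 1) ^ n) := by ring
    _ = _ := by
      rw [← pow_add, ← pow_add, Nat.sub_add_cancel h1, Nat.sub_add_cancel h2, ← h, mul_pow]
      ring

end Colourings

/-! ### Numbering the subsets of a bag -/

/-- The number of `A ∩ B ∩ {0, …, k - 1}` in the enumeration of the subsets of `B`. -/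
def enc (B A : Finset ℕ) : ℕ → ℕ
  | 0 => 0
  | k + 1 => enc B A k + if k ∈ B ∧ k ∈ A then 2 ^ Nat.count (· ∈ B) k else 0

/-- The subset of `B ∩ {0, …, k - 1}` with number `i`. -/
def dec (B : Finset ℕ) (i k : ℕ) : Finset ℕ :=
  (Finset.range k).filter fun v => v ∈ B ∧ i.testBit (Nat.count (· ∈ B) v) = true

theorem enc_congr {B A A' : Finset ℕ} {k : ℕ} (h : ∀ v < k, v ∈ B → (v ∈ A ↔ v ∈ A')) :
    enc B A k = enc B A' k := by
  induction k with
  | zero => rfl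
  | succ k ih =>
    rw [enc, enc, ih fun v hv => h v (by omega)]
    congr 1
    by_cases hk : k ∈ B
    · simp [hk, h k (by omega) hk]
    · simp [hk]

theorem enc_inter (B A : Finset ℕ) (k : ℕ) : enc B (A ∩ B) k = enc B A k :=
  enc_congr fun v _ hv => by simp [hv]

theorem enc_lt (B A : Finset ℕ) (k : ℕ) : enc B A k < 2 ^ Nat.count (· ∈ B) k := by
  induction k with
  | zero => simp [enc]
  | succ k ih =>
    rw [enc, Nat.count_succ]
    by_cases hk : k ∈ B
    · simp only [hk, true_and, if_true, pow_succ]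
      split_ifs <;> omega
    · simpa [hk] using ih

/-- A vertex of `B` owns the binary digit whose position is its rank in `B`. By `enc_lt` the earlier
summands stay below that power of two, and later ones are strictly higher powers, so there are no
carries. -/
theorem testBit_enc (B A : Finset ℕ) {k v : ℕ} (hv : v < k) (hB : v ∈ B) :
    (enc B A k).testBit (Nat.count (· ∈ B) v) = decide (v ∈ A) := by
  induction k with
  | zero => omega
  | succ k ih =>
    rw [enc]
    rcases Nat.lt_succ_iff_lt_or_eq.1 hv with h | rfl
    · rw [← ih h]
      split_ifs
      · rw [add_comm, Nat.testBit_two_pow_add_gt (Nat.count_strict_mono hB h)]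
      · rfl
    · by_cases hA : v ∈ A
      · simp only [hB, hA, true_and, if_true]
        rw [add_comm, Nat.testBit_two_pow_add_eq, Nat.testBit_lt_two_pow (enc_lt B A v)]
        simp
      · simp only [hA, and_false, if_false, add_zero]
        rw [Nat.testBit_lt_two_pow (enc_lt B A v)]
        simp

theorem enc_dec (B : Finset ℕ) {i k k' : ℕ} (hk : k ≤ k') :
    enc B (dec B i k') k = i % 2 ^ Nat.count (· ∈ B) k := by
  induction k with
  | zero => simp [enc, Nat.mod_one]
  | succ k ih =>
    rw [enc, ih (by omega), Nat.count_succ]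
    by_cases hB : k ∈ B
    · simp only [hB, true_and, if_true, dec, Finset.mem_filter, Finset.mem_range]
      rw [Nat.mod_pow_succ, Nat.testBit_eq_decide_div_mod_eq]
      have : k < k' := by omega
      simp only [this, true_and, decide_eq_true_iff]
      rcases Nat.mod_two_eq_zero_or_one (i / 2 ^ Nat.count (· ∈ B) k) with h | h <;> simp [h]
    · simp [hB]

theorem dec_enc (B A : Finset ℕ) (k : ℕ) :
    dec B (enc B A k) k = (A ∩ B).filter (· < k) := by
  ext v
  simp only [dec, Finset.mem_filter, Finset.mem_range, Finset.mem_inter]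
  constructor
  · rintro ⟨hv, hB, h⟩
    rw [testBit_enc B A hv hB] at h
    exact ⟨⟨of_decide_eq_true h, hB⟩, hv⟩
  · rintro ⟨⟨hA, hB⟩, hv⟩
    exact ⟨hv, hB, by rw [testBit_enc B A hv hB]; simpa using hA⟩

theorem dec_subset (B : Finset ℕ) (i k : ℕ) : dec B i k ⊆ B := fun v hv => by
  simp only [dec, Finset.mem_filter] at hv
  exact hv.2.1

theorem mem_dec_iff {B : Finset ℕ} {i k v : ℕ} (hv : v < k) (hB : v ∈ B) :
    v ∈ dec B i k ↔ i / 2 ^ Nat.count (· ∈ B) v % 2 = 1 := by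
  simp [dec, hv, hB, Nat.testBit_eq_decide_div_mod_eq]

theorem count_eq_card {B : Finset ℕ} {n : ℕ} (hB : B ⊆ Finset.range n) :
    Nat.count (· ∈ B) n = B.card := by
  rw [Nat.count_eq_card_filter_range]
  congr 1
  ext v
  simp only [Finset.mem_filter, Finset.mem_range, and_iff_right_iff_imp]
  exact fun h => Finset.mem_range.1 (hB h)

/-- Translates a program loop over table indices into a sum over subsets of the bag. The summand may
use the index as well as the set. -/
theorem sum_powerset_eq_sum_range {B : Finset ℕ} {n : ℕ} (hB : B ⊆ Finset.range n)
    (g : ℕ → Finset ℕ → ℂ) :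
    ∑ A ∈ B.powerset, g (enc B A n) A =
      ∑ i ∈ Finset.range (2 ^ Nat.count (· ∈ B) n), g i (dec B i n) := by
  have hlt : ∀ A ∈ B.powerset, dec B (enc B A n) n = A := by
    intro A hA
    rw [Finset.mem_powerset] at hA
    rw [dec_enc, Finset.inter_eq_left.2 hA, Finset.filter_eq_self]
    exact fun v hv => Finset.mem_range.1 (hB (hA hv))
  refine Finset.sum_nbij' (fun A => enc B A n) (fun i => dec B i n) ?_ ?_ hlt ?_ ?_
  · exact fun A _ => Finset.mem_range.2 (enc_lt B A n)
  · exact fun i _ => Finset.mem_powerset.2 (dec_subset B i n)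
  · intro i hi
    rw [enc_dec B le_rfl, Nat.mod_eq_of_lt (Finset.mem_range.1 hi)]
  · intro A hA
    rw [hlt A hA]

/-! ### Eliminating a node -/

/-- The value of a family of tables on the subsets of the bags of the nodes in `S`. -/
noncomputable def tableSum (bag : ℕ → Finset ℕ) (S : Finset ℕ) (F : ℕ → Finset ℕ → ℂ) : ℂ :=
  ∑ A ∈ (S.biUnion bag).powerset, ∏ x ∈ S, F x (A ∩ bag x)

/-- Group the subsets `A` of the full union by their trace `A'` on the union `V'` of the other bags.
Every factor except that of `x` depends on `A'` alone. By `hsep`, `V' ∩ bag x` lies in `bag p`, so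
the possible traces `R` on `bag x` are constrained only by agreement with `A'` on `bag x ∩ bag p`.
-/
theorem tableSum_erase {bag : ℕ → Finset ℕ} {S : Finset ℕ} {F F' : ℕ → Finset ℕ → ℂ} {x p : ℕ}
    (hx : x ∈ S) (hp : p ∈ S) (hne : p ≠ x) (hsep : ∀ y ∈ S, y ≠ x → bag x ∩ bag y ⊆ bag p)
    (hF : ∀ y ∈ S, y ≠ x → y ≠ p → ∀ A ⊆ bag y, F' y A = F y A)
    (hFp : ∀ A ⊆ bag p, F' p A = F p A *
      ∑ R ∈ (bag x).powerset with R ∩ bag p = A ∩ bag x, F x R) :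
    tableSum bag (S.erase x) F' = tableSum bag S F := by
  classical
  set V' := (S.erase x).biUnion bag with hV'
  set V := S.biUnion bag with hV
  have hbag : ∀ y ∈ S, y ≠ x → bag y ⊆ V' := fun y hy hyx =>
    Finset.subset_biUnion_of_mem bag (Finset.mem_erase.2 ⟨hyx, hy⟩)
  have hVV : V = V' ∪ bag x := by
    rw [hV, hV', ← Finset.insert_erase hx, Finset.biUnion_insert, Finset.union_comm,
      Finset.erase_insert (Finset.notMem_erase x S)]
  have hxV : V' ∩ bag x ⊆ bag p := by
    intro v hv
    rw [Finset.mem_inter, hV', Finset.mem_biUnion] at hv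
    obtain ⟨⟨y, hy, hvy⟩, hvx⟩ := hv
    rw [Finset.mem_erase] at hy
    exact hsep y hy.2 hy.1 (Finset.mem_inter.2 ⟨hvx, hvy⟩)
  have hpV := hbag p hp hne
  unfold tableSum
  rw [← Finset.sum_fiberwise_of_maps_to (s := V.powerset) (t := V'.powerset) (g := fun A => A ∩ V')
    (fun A _ => Finset.mem_powerset.2 Finset.inter_subset_right)]
  refine Finset.sum_congr rfl fun A' hA' => ?_
  rw [Finset.mem_powerset] at hA'
  have hpx : p ∈ S.erase x := Finset.mem_erase.2 ⟨hne, hp⟩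
  rw [← Finset.mul_prod_erase _ _ hpx, hFp _ Finset.inter_subset_right]
  have hrest : ∀ A ∈ V.powerset.filter (fun A => A ∩ V' = A'),
      ∏ y ∈ S, F y (A ∩ bag y) = (F p (A' ∩ bag p) *
        ∏ y ∈ (S.erase x).erase p, F' y (A' ∩ bag y)) * F x (A ∩ bag x) := by
    intro A hA
    rw [Finset.mem_filter] at hA
    have hAb : ∀ y ∈ S, y ≠ x → A' ∩ bag y = A ∩ bag y := fun y hy hyx => by
      rw [← hA.2, Finset.inter_assoc, Finset.inter_eq_right.2 (hbag y hy hyx)]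
    rw [← Finset.mul_prod_erase _ _ hx, ← Finset.mul_prod_erase _ _ hpx, mul_comm, hAb p hp hne]
    congr 2
    refine Finset.prod_congr rfl fun y hy => ?_
    simp only [Finset.mem_erase] at hy
    rw [hF y hy.2.2 hy.2.1 hy.1 _ Finset.inter_subset_right, hAb y hy.2.2 hy.2.1]
  rw [Finset.sum_congr rfl hrest, ← Finset.mul_sum, mul_right_comm]
  congr 1
  symm
  -- Within one fibre, `A` is recovered from its trace `R` on `bag x` as `A' ∪ R`.
  refine Finset.sum_nbij' (fun A => A ∩ bag x) (fun R => A' ∪ R) ?_ ?_ ?_ ?_ ?_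
  · intro A hA
    simp only [Finset.mem_filter, Finset.mem_powerset] at hA ⊢
    refine ⟨Finset.inter_subset_right, ?_⟩
    obtain ⟨hAV, rfl⟩ := hA
    ext v; have := @hpV v; simp only [Finset.mem_inter]; tauto
  · intro R hR
    simp only [Finset.mem_filter, Finset.mem_powerset] at hR ⊢
    obtain ⟨hRx, hR⟩ := hR
    constructor
    · rw [hVV]; exact Finset.union_subset_union hA' hRx
    · ext v
      have h1 := @hxV v; have h2 := @hRx v; have h3 := @hA' v
      have h4 := Finset.ext_iff.1 hR v
      simp only [Finset.mem_inter, Finset.mem_union] at *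
      tauto
  · intro A hA
    simp only [Finset.mem_filter, Finset.mem_powerset] at hA
    obtain ⟨hAV, rfl⟩ := hA
    rw [hVV] at hAV
    ext v; have := @hAV v; simp only [Finset.mem_inter, Finset.mem_union] at *; tauto
  · intro R hR
    simp only [Finset.mem_filter, Finset.mem_powerset] at hR
    obtain ⟨hRx, hR⟩ := hR
    ext v
    have h1 := @hxV v; have h2 := @hRx v; have h3 := @hA' v
    have h4 := Finset.ext_iff.1 hR v
    simp only [Finset.mem_inter, Finset.mem_union] at *
    tauto
  · intro A _; rfl

/-! ### Leaves -/

/-- Any two elements of `S` are joined by a path of `adj` inside `S`. -/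
def ConnectedOn (adj : ℕ → ℕ → Prop) (S : Finset ℕ) : Prop :=
  ∀ x ∈ S, ∀ y ∈ S, Relation.ReflTransGen (fun a b => a ∈ S ∧ b ∈ S ∧ adj a b) x y

/-- `p` is the only neighbour of `x` in `S`. -/
def IsLeafOn (adj : ℕ → ℕ → Prop) (S : Finset ℕ) (x p : ℕ) : Prop :=
  x ∈ S ∧ p ∈ S ∧ adj x p ∧ ∀ y ∈ S, adj x y → y = p

/-- If `p` is a second element of `S`, sending `x` to `p` turns a path in `S` into a path that
avoids `x`. Otherwise no element of `S` other than possibly `x` is adjacent to `x`, and a path that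
starts elsewhere never visits `x`. Membership of `p` in `S` is not assumed because the lemma is also
applied to the nodes whose bags contain a given vertex. -/
theorem ConnectedOn.erase_leaf {adj : ℕ → ℕ → Prop} (hsymm : ∀ a b, adj a b → adj b a)
    {S : Finset ℕ} (hS : ConnectedOn adj S) {x p : ℕ} (hp : ∀ y ∈ S, adj x y → y = p) :
    ConnectedOn adj (S.erase x) := by
  classical
  intro y hy z hz
  rw [Finset.mem_erase] at hy hz
  by_cases hpS : p ∈ S ∧ p ≠ x
  · have := Relation.ReflTransGen.lift' (p := fun a b => a ∈ S.erase x ∧ b ∈ S.erase x ∧ adj a b)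
      (fun a => if a = x then p else a) ?_ y z (hS y hy.2 z hz.2)
    · simpa [Function.onFun, hy.1, hz.1] using this
    · intro a b hab
      simp only [Function.onFun, Finset.mem_erase]
      by_cases ha : a = x <;> by_cases hb : b = x
      · simp only [ha, hb, if_true]; exact .refl
      · rw [hp b hab.2.1 (ha ▸ hab.2.2)]; simp [ha, Relation.ReflTransGen.refl]
      · rw [hp a hab.1 (hsymm _ _ (hb ▸ hab.2.2))]; simp [hb, Relation.ReflTransGen.refl]
      · simp only [ha, hb, if_false]
        exact .single ⟨⟨ha, hab.1⟩, ⟨hb, hab.2.1⟩, hab.2.2⟩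
  · refine Relation.ReflTransGen.head_induction_on (motive := fun a _ => a ≠ x → Relation.ReflTransGen
        (fun a b => a ∈ S.erase x ∧ b ∈ S.erase x ∧ adj a b) a z)
      (hS y hy.2 z hz.2) (fun _ => Relation.ReflTransGen.refl) ?_ hy.1
    intro a c hac _ ih ha
    by_cases hc : c = x
    · have := hp a hac.1 (hsymm _ _ (hc ▸ hac.2.2))
      exact absurd ⟨this ▸ hac.1, this ▸ ha⟩ hpS
    · exact .head ⟨Finset.mem_erase.2 ⟨ha, hac.1⟩, Finset.mem_erase.2 ⟨hc, hac.2.1⟩, hac.2.2⟩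
        (ih hc)

theorem ConnectedOn.exists_adj {adj : ℕ → ℕ → Prop} {S : Finset ℕ} (hS : ConnectedOn adj S)
    {x y : ℕ} (hx : x ∈ S) (hy : y ∈ S) (hne : x ≠ y) : ∃ z ∈ S, adj x z := by
  rcases Relation.ReflTransGen.cases_head (hS x hx y hy) with h | ⟨z, hz, _⟩
  · exact absurd h hne
  · exact ⟨z, hz.2.1, hz.2.2⟩

/-- The adjacency relation of a graph on `Fin t`, on the natural numbers. -/
def natAdj {t : ℕ} (T : SimpleGraph (Fin t)) (x y : ℕ) : Prop :=
  ∃ (hx : x < t) (hy : y < t), T.Adj ⟨x, hx⟩ ⟨y, hy⟩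

theorem natAdj_symm {t : ℕ} (T : SimpleGraph (Fin t)) (x y : ℕ) (h : natAdj T x y) :
    natAdj T y x :=
  let ⟨hx, hy, h⟩ := h
  ⟨hy, hx, h.symm⟩

theorem connectedOn_of_induce {t : ℕ} {T : SimpleGraph (Fin t)} {S : Finset ℕ}
    (hS : ∀ x ∈ S, x < t) (h : (T.induce {x : Fin t | (x : ℕ) ∈ S}).Preconnected) :
    ConnectedOn (natAdj T) S := by
  intro x hx y hy
  obtain ⟨w⟩ := h ⟨⟨x, hS x hx⟩, hx⟩ ⟨⟨y, hS y hy⟩, hy⟩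
  have key : ∀ {a b : {x : Fin t | (x : ℕ) ∈ S}} (_ : (T.induce _).Walk a b),
      Relation.ReflTransGen (fun a b => a ∈ S ∧ b ∈ S ∧ natAdj T a b) (a : Fin t) (b : Fin t) := by
    intro a b w
    induction w with
    | nil => exact .refl
    | @cons a b c hab _ ih => exact .head ⟨a.2, b.2, a.1.2, b.1.2, hab⟩ ih
  exact key w

/-- A connected induced subgraph of a forest is a tree, and a tree with at least two nodes has a
node of degree one. -/
theorem ConnectedOn.exists_leaf {t : ℕ} {T : SimpleGraph (Fin t)} (hT : T.IsAcyclic)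
    {S : Finset ℕ} (hS : ∀ x ∈ S, x < t) (hc : ConnectedOn (natAdj T) S) (hcard : 2 ≤ S.card) :
    ∃ x p, IsLeafOn (natAdj T) S x p := by
  classical
  obtain ⟨u, hu, v, hv, huv⟩ := Finset.one_lt_card.1 hcard
  let U : Set (Fin t) := {x : Fin t | (x : ℕ) ∈ S}
  have hne : Nontrivial U :=
    ⟨⟨⟨⟨u, hS u hu⟩, hu⟩, ⟨⟨v, hS v hv⟩, hv⟩, fun h => huv (by simpa using h)⟩⟩
  have hpre : (T.induce U).Preconnected := by
    have key : ∀ x y, Relation.ReflTransGen (fun a b => a ∈ S ∧ b ∈ S ∧ natAdj T a b) x y →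
        ∀ (hx : x ∈ S) (hy : y ∈ S),
          (T.induce U).Reachable ⟨⟨x, hS x hx⟩, hx⟩ ⟨⟨y, hS y hy⟩, hy⟩ := by
      intro x y h
      induction h with
      | refl => exact fun _ _ => .rfl
      | tail _ hab ih =>
        intro hx hy
        refine (ih hx hab.1).trans (SimpleGraph.Adj.reachable ?_)
        exact hab.2.2.2.2
    rintro ⟨⟨x, _⟩, hx⟩ ⟨⟨y, _⟩, hy⟩
    exact key x y (hc x hx y hy) hx hy
  have htree : (T.induce U).IsTree := ⟨⟨hpre⟩, hT.induce U⟩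
  obtain ⟨x, hx⟩ := htree.exists_vert_degree_one_of_nontrivial
  rw [SimpleGraph.degree_eq_one_iff_existsUnique_adj] at hx
  obtain ⟨p, hp, hu⟩ := hx
  refine ⟨x.1, p.1, x.2, p.2, ⟨x.1.2, p.1.2, hp⟩, fun y hy hxy => ?_⟩
  obtain ⟨_, hyt, hadj⟩ := hxy
  have := hu ⟨⟨y, hyt⟩, hy⟩ hadj
  rw [← this]


/-! ### Reasoning about programs -/

/-- The word registers that a program may write. -/
def Program.regs : Program → List ℕ
  | .setReg r _ => [r]
  | .testZero r _ => [r]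
  | .seq p q => p.regs ++ q.regs
  | .ite _ p q => p.regs ++ q.regs
  | .loop _ p => p.regs
  | _ => []

/-- The word arrays that a program may write. -/
def Program.words : Program → List ℕ
  | .setWord k _ _ => [k]
  | .seq p q => p.words ++ q.words
  | .ite _ p q => p.words ++ q.words
  | .loop _ p => p.words
  | _ => []

/-- The number arrays that a program may write. -/
def Program.nums : Program → List ℕ
  | .setNum k _ _ => [k]
  | .seq p q => p.nums ++ q.nums
  | .ite _ p q => p.nums ++ q.nums
  | .loop _ p => p.nums
  | _ => []

/-- `s'` agrees with `s` on everything that `p` does not write. -/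
structure Frame (p : Program) (s s' : Store) : Prop where
  reg : ∀ r, r ∉ p.regs → s'.reg r = s.reg r
  word : ∀ k, k ∉ p.words → s'.word k = s.word k
  num : ∀ k, k ∉ p.nums → s'.num k = s.num k

theorem Frame.refl (p : Program) (s : Store) : Frame p s s :=
  ⟨fun _ _ => rfl, fun _ _ => rfl, fun _ _ => rfl⟩

theorem Frame.trans {p : Program} {s s' s'' : Store} (h : Frame p s s') (h' : Frame p s' s'') :
    Frame p s s'' :=
  ⟨fun r hr => (h'.reg r hr).trans (h.reg r hr), fun k hk => (h'.word k hk).trans (h.word k hk),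
    fun k hk => (h'.num k hk).trans (h.num k hk)⟩

theorem Frame.mono {p q : Program} {s s' : Store} (h : Frame p s s') (hr : p.regs ⊆ q.regs)
    (hw : p.words ⊆ q.words) (hn : p.nums ⊆ q.nums) : Frame q s s' :=
  ⟨fun r h' => h.reg r fun h'' => h' (hr h''), fun k h' => h.word k fun h'' => h' (hw h''),
    fun k h' => h.num k fun h'' => h' (hn h'')⟩

@[simp] theorem Store.setReg_reg (s : Store) (r x r' : ℕ) :
    (s.setReg r x).reg r' = if r' = r then x else s.reg r' := by
  simp [Store.setReg, Function.update_apply]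

@[simp] theorem Store.setReg_word (s : Store) (r x : ℕ) : (s.setReg r x).word = s.word := rfl

@[simp] theorem Store.setReg_num (s : Store) (r x : ℕ) : (s.setReg r x).num = s.num := rfl

@[simp] theorem Store.setWord_reg (s : Store) (k i x : ℕ) : (s.setWord k i x).reg = s.reg := rfl

@[simp] theorem Store.setWord_num (s : Store) (k i x : ℕ) : (s.setWord k i x).num = s.num := rfl

@[simp] theorem Store.setWord_word (s : Store) (k i x k' i' : ℕ) :
    (s.setWord k i x).word k' i' = if k' = k ∧ i' = i then x else s.word k' i' := by
  by_cases hk : k' = k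
  · subst hk; simp [Store.setWord, Function.update_apply]
  · simp [Store.setWord, hk]

@[simp] theorem Store.setNum_reg (s : Store) (k i : ℕ) (z : ℂ) : (s.setNum k i z).reg = s.reg := rfl

@[simp] theorem Store.setNum_word (s : Store) (k i : ℕ) (z : ℂ) :
    (s.setNum k i z).word = s.word := rfl

@[simp] theorem Store.setNum_num (s : Store) (k i : ℕ) (z : ℂ) (k' i' : ℕ) :
    (s.setNum k i z).num k' i' = if k' = k ∧ i' = i then z else s.num k' i' := by
  by_cases hk : k' = k
  · subst hk; simp [Store.setNum, Function.update_apply]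
  · simp [Store.setNum, hk]

/-- Preservation of memory becomes a syntactic question about the program text, which `decide`
settles for concrete programs. -/
theorem Exec.frame {w : ℕ} {p : Program} {s s' : Store} {T : ℕ} (h : Exec w p s T s') :
    Frame p s s' := by
  induction h with
  | skip s => exact .refl _ _
  | setReg s r e =>
    exact ⟨fun r' hr => by simp_all [Program.regs], fun _ _ => rfl, fun _ _ => rfl⟩
  | setWord s k a e =>
    refine ⟨fun _ _ => rfl, fun k' hk => ?_, fun _ _ => rfl⟩
    funext i; simp_all [Program.words]
  | setNum s k a e =>
    refine ⟨fun _ _ => rfl, fun _ _ => rfl, fun k' hk => ?_⟩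
    funext i; simp_all [Program.nums]
  | testZero s r f =>
    exact ⟨fun r' hr => by simp_all [Program.regs], fun _ _ => rfl, fun _ _ => rfl⟩
  | seq _ _ ihp ihq =>
    exact (ihp.mono (by simp [Program.regs]) (by simp [Program.words])
      (by simp [Program.nums])).trans
        (ihq.mono (by simp [Program.regs]) (by simp [Program.words]) (by simp [Program.nums]))
  | iteTrue _ _ ih =>
    exact ih.mono (by simp [Program.regs]) (by simp [Program.words]) (by simp [Program.nums])
  | iteFalse _ _ ih =>
    exact ih.mono (by simp [Program.regs]) (by simp [Program.words]) (by simp [Program.nums])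
  | loopStop _ => exact .refl _ _
  | loopStep _ _ _ ihp ihl =>
    exact (ihp.mono (by simp [Program.regs]) (by simp [Program.words])
      (by simp [Program.nums])).trans ihl

/-- Started on `s`, the program `p` halts within `B` steps on a memory that satisfies `Q`. -/
def Runs (w : ℕ) (p : Program) (s : Store) (B : ℕ) (Q : Store → Prop) : Prop :=
  ∃ T s', Exec w p s T s' ∧ T ≤ B ∧ Q s'

section Rules

variable {w : ℕ} {p q : Program} {s : Store} {B B₁ B₂ : ℕ} {Q Q₁ : Store → Prop}

theorem Runs.mono (h : Runs w p s B₁ Q₁) (hB : B₁ ≤ B)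
    (hQ : ∀ s', Q₁ s' → Frame p s s' → Q s') : Runs w p s B Q :=
  let ⟨T, s', he, hT, hs⟩ := h
  ⟨T, s', he, hT.trans hB, hQ s' hs he.frame⟩

theorem Runs.weaken (hB : B₁ ≤ B) (h : Runs w p s B₁ Q) : Runs w p s B Q :=
  h.mono hB fun _ h _ => h

theorem Runs.skip (h : Q s) : Runs w .skip s 1 Q := ⟨_, _, .skip s, le_rfl, h⟩

theorem Runs.setReg {r : ℕ} {e : WordExpr} (h : Q (s.setReg r (e.eval w s))) :
    Runs w (.setReg r e) s (e.cost + 1) Q :=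
  ⟨_, _, .setReg s r e, le_rfl, h⟩

theorem Runs.setWord {k : ℕ} {a e : WordExpr} (h : Q (s.setWord k (a.eval w s) (e.eval w s))) :
    Runs w (.setWord k a e) s (a.cost + e.cost + 1) Q :=
  ⟨_, _, .setWord s k a e, le_rfl, h⟩

theorem Runs.setNum {k : ℕ} {a : WordExpr} {f : NumExpr}
    (h : Q (s.setNum k (a.eval w s) (f.eval w s))) :
    Runs w (.setNum k a f) s (a.cost + f.cost + 1) Q :=
  ⟨_, _, .setNum s k a f, le_rfl, h⟩

open Classical in
theorem Runs.testZero {r : ℕ} {f : NumExpr} (hw : 1 < 2 ^ w)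
    (h : Q (s.setReg r (if f.eval w s = 0 then 1 else 0))) :
    Runs w (.testZero r f) s (f.cost + 1) Q := by
  refine ⟨_, _, .testZero s r f, le_rfl, ?_⟩
  rw [Nat.mod_eq_of_lt]
  · exact h
  · split_ifs <;> omega

theorem Runs.seq (hp : Runs w p s B₁ Q₁)
    (hq : ∀ s', Q₁ s' → Frame p s s' → Runs w q s' B₂ Q) : Runs w (.seq p q) s (B₁ + B₂) Q :=
  let ⟨_, s', he, hT, hs⟩ := hp
  let ⟨_, s'', he', hT', hs'⟩ := hq s' hs he.frame
  ⟨_, s'', .seq he he', Nat.add_le_add hT hT', hs'⟩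

theorem Runs.setReg_seq {r : ℕ} {e : WordExpr}
    (h : Runs w q (s.setReg r (e.eval w s)) B Q) :
    Runs w (.seq (.setReg r e) q) s (e.cost + 1 + B) Q :=
  let ⟨_, s'', he', hT', hs'⟩ := h
  ⟨_, s'', .seq (.setReg s r e) he', Nat.add_le_add le_rfl hT', hs'⟩

theorem Runs.setNum_seq {k : ℕ} {a : WordExpr} {f : NumExpr}
    (h : Runs w q (s.setNum k (a.eval w s) (f.eval w s)) B Q) :
    Runs w (.seq (.setNum k a f) q) s (a.cost + f.cost + 1 + B) Q :=
  let ⟨_, s'', he', hT', hs'⟩ := h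
  ⟨_, s'', .seq (.setNum s k a f) he', Nat.add_le_add le_rfl hT', hs'⟩

theorem Runs.setWord_seq {k : ℕ} {a e : WordExpr}
    (h : Runs w q (s.setWord k (a.eval w s) (e.eval w s)) B Q) :
    Runs w (.seq (.setWord k a e) q) s (a.cost + e.cost + 1 + B) Q :=
  let ⟨_, s'', he', hT', hs'⟩ := h
  ⟨_, s'', .seq (.setWord s k a e) he', Nat.add_le_add le_rfl hT', hs'⟩

theorem Runs.ite {e : WordExpr} (hp : e.eval w s ≠ 0 → Runs w p s B Q)
    (hq : e.eval w s = 0 → Runs w q s B Q) : Runs w (.ite e p q) s (e.cost + 1 + B) Q := by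
  by_cases he : e.eval w s = 0
  · obtain ⟨T, s', h, hT, hs⟩ := hq he
    exact ⟨_, s', .iteFalse he h, Nat.add_le_add le_rfl hT, hs⟩
  · obtain ⟨T, s', h, hT, hs⟩ := hp he
    exact ⟨_, s', .iteTrue he h, Nat.add_le_add le_rfl hT, hs⟩

/-- `for r = 0, …, reg b - 1 do p` -/
def forLoop (r b : ℕ) (p : Program) : Program :=
  .seq (.setReg r (.const 0)) (.loop (.op .lt (.reg r) (.reg b))
    (.seq p (.setReg r (.op .add (.reg r) (.const 1)))))

/-- Besides the body, a round pays 4 steps for the test and 4 for the increment; initialising the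
counter (2) and the failing test (4) give the final 6. The invariant must ignore the counter
register, which changes between rounds. The bound on `N` keeps the counter from wrapping around. -/
theorem Runs.forLoop {r b N c : ℕ} (I : ℕ → Store → Prop) (hb : s.reg b = N) (hN : N < 2 ^ w)
    (hr : r ∉ p.regs) (hbp : b ∉ p.regs) (hrb : b ≠ r)
    (hI : ∀ i s x, I i s → I i (s.setReg r x)) (h0 : I 0 s)
    (step : ∀ i s', i < N → s'.reg r = i → I i s' → Frame (forLoop r b p) s s' →
      Runs w p s' c (I (i + 1))) :
    Runs w (forLoop r b p) s (N * (c + 8) + 6) (I N) := by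
  -- Induction on the number `j` of rounds still to come.
  have key : ∀ j i s', i + j = N → s'.reg r = i → s'.reg b = N → I i s' →
      Frame (TutteRAM.forLoop r b p) s s' →
      Runs w (.loop (.op .lt (.reg r) (.reg b))
        (.seq p (.setReg r (.op .add (.reg r) (.const 1))))) s' (j * (c + 8) + 4) (I N) := by
    intro j
    induction j with
    | zero =>
      intro i s' hij hri hsb hi _
      obtain rfl : i = N := by simpa using hij
      refine ⟨_, s', .loopStop ?_, ?_, hi⟩
      · simp [WordExpr.eval, WordOp.eval, hri, hsb]
      · simp [WordExpr.cost]
    | succ j ih =>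
      intro i s' hij hri hsb hi hF
      obtain ⟨T, s₁, he, hT, hs⟩ := step i s' (by omega) hri hi hF
      have hF₁ := he.frame
      have h1 : s₁.reg r = i := by rw [hF₁.reg r hr, hri]
      have hlt : i + 1 < 2 ^ w := by omega
      have hmod : 1 % 2 ^ w = 1 := Nat.mod_eq_of_lt (by omega)
      have hmod' : (i + 1) % 2 ^ w = i + 1 := Nat.mod_eq_of_lt hlt
      have hev : WordExpr.eval w s₁ (.op .add (.reg r) (.const 1)) = i + 1 := by
        simp [WordExpr.eval, WordOp.eval, h1, hmod']
      obtain ⟨T', s₂, he', hT', hs'⟩ := ih (i + 1) (s₁.setReg r (i + 1)) (by omega) (by simp)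
        (by simp [hrb, hF₁.reg b hbp, hsb]) (hI _ _ _ hs)
        (hF.trans ((hF₁.mono (by simp [TutteRAM.forLoop, Program.regs])
          (by simp [TutteRAM.forLoop, Program.words])
          (by simp [TutteRAM.forLoop, Program.nums])).trans
          ⟨fun r' hr' => by simp_all [TutteRAM.forLoop, Program.regs], fun _ _ => rfl,
            fun _ _ => rfl⟩))
      refine ⟨_, s₂, .loopStep ?_ (.seq he (.setReg s₁ r _)) (hev ▸ he'), ?_, hs'⟩
      · have : i < N := by omega
        simp [WordExpr.eval, WordOp.eval, hri, hsb, this, hmod]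
      · simp only [WordExpr.cost]
        rw [Nat.succ_mul]
        omega
  have h := key N 0 (s.setReg r 0) (by simp) (by simp) (by simp [hrb, hb])
    (hI _ _ _ h0) ⟨fun r' hr' => by simp_all [TutteRAM.forLoop, Program.regs], fun _ _ => rfl,
      fun _ _ => rfl⟩
  have h' : (WordExpr.const 0).eval w s = 0 := by simp [WordExpr.eval]
  rw [← h'] at h
  refine Runs.weaken ?_ (Runs.setReg_seq h)
  simp only [WordExpr.cost]
  omega

end Rules

/-! ### Evaluation of expressions without overflow -/

section Eval

variable {w : ℕ} {s : Store} {e₁ e₂ : WordExpr} {x y : ℕ}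

theorem eval_reg {r : ℕ} (h : s.reg r = x) : (WordExpr.reg r).eval w s = x := h

theorem eval_const (h : x < 2 ^ w) : (WordExpr.const x).eval w s = x := Nat.mod_eq_of_lt h

theorem eval_add (h₁ : e₁.eval w s = x) (h₂ : e₂.eval w s = y) (h : x + y < 2 ^ w) :
    (WordExpr.op .add e₁ e₂).eval w s = x + y := by
  simp only [WordExpr.eval, WordOp.eval, h₁, h₂, Nat.mod_eq_of_lt h]

theorem eval_mul (h₁ : e₁.eval w s = x) (h₂ : e₂.eval w s = y) (h : x * y < 2 ^ w) :
    (WordExpr.op .mul e₁ e₂).eval w s = x * y := by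
  simp only [WordExpr.eval, WordOp.eval, h₁, h₂, Nat.mod_eq_of_lt h]

/-- Word expressions have no branching; multiplication by a truth value takes its place. -/
theorem eval_mul_ite (c : Prop) [Decidable c] (h₁ : e₁.eval w s = x)
    (h₂ : e₂.eval w s = if c then 1 else 0) (h : x < 2 ^ w) :
    (WordExpr.op .mul e₁ e₂).eval w s = if c then x else 0 := by
  rw [eval_mul h₁ h₂]
  · split_ifs <;> simp
  · split_ifs <;> omega

theorem eval_and (c d : Prop) [Decidable c] [Decidable d] (hw : 1 < 2 ^ w)
    (h₁ : e₁.eval w s = if c then 1 else 0) (h₂ : e₂.eval w s = if d then 1 else 0) :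
    (WordExpr.op .mul e₁ e₂).eval w s = if c ∧ d then 1 else 0 := by
  rw [eval_mul_ite d h₁ h₂ (by split_ifs <;> omega)]
  split_ifs <;> simp_all

theorem eval_eq (hw : 1 < 2 ^ w) (h₁ : e₁.eval w s = x) (h₂ : e₂.eval w s = y) :
    (WordExpr.op .eq e₁ e₂).eval w s = if x = y then 1 else 0 := by
  simp only [WordExpr.eval, WordOp.eval, h₁, h₂]
  rw [Nat.mod_eq_of_lt]
  split_ifs <;> omega

/-- The binary digit of `e₁` that belongs to the power of two `e₂`. -/
def bitExpr (e₁ e₂ : WordExpr) : WordExpr := .op .mod (.op .div e₁ e₂) (.const 2)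

theorem eval_bit (hw : 2 < 2 ^ w) (h₁ : e₁.eval w s = x) (h₂ : e₂.eval w s = y) (h : x < 2 ^ w) :
    (bitExpr e₁ e₂).eval w s = if x / y % 2 = 1 then 1 else 0 := by
  simp only [bitExpr, WordExpr.eval, WordOp.eval, h₁, h₂]
  rw [Nat.mod_eq_of_lt (lt_of_le_of_lt (Nat.div_le_self x y) h), Nat.mod_eq_of_lt hw,
    Nat.mod_eq_of_lt (by omega)]
  split_ifs <;> omega

end Eval

/-! ### The input of the programs -/

/-- A graph with a family of bags and a relation on the nodes, on the natural numbers, and a word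
length that suffices for the tables. -/
structure BagData where
  (w n m t K : ℕ)
  bag : ℕ → Finset ℕ
  adj : ℕ → ℕ → Prop
  (u v : ℕ → ℕ)
  bag_subset : ∀ x, bag x ⊆ Finset.range n
  pow_le : ∀ x, 2 ^ Nat.count (· ∈ bag x) n ≤ K
  u_lt : ∀ e < m, u e < n
  v_lt : ∀ e < m, v e < n
  edge_mem : ∀ e < m, ∃ x < t, u e ∈ bag x ∧ v e ∈ bag x
  biUnion_bag : (Finset.range t).biUnion bag = Finset.range n
  adj_symm : ∀ x y, adj x y → adj y x
  connectedOn : ConnectedOn adj (Finset.range t)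
  connectedOn_bag : ∀ v, ConnectedOn adj ((Finset.range t).filter fun x => v ∈ bag x)
  exists_leaf : ∀ S ⊆ Finset.range t, ConnectedOn adj S → 2 ≤ S.card → ∃ x p, IsLeafOn adj S x p
  t_pos : 0 < t
  four_lt : 4 < 2 ^ w
  n_lt : n < 2 ^ w
  m_lt : m < 2 ^ w
  -- These three products bound the addresses in the tables, the membership matrix and the adjacency
  -- matrix.
  K_mul_lt : K * t < 2 ^ w
  t_mul_n_lt : t * n < 2 ^ w
  t_mul_t_lt : t * t < 2 ^ w

open Classical in
/-- The memory holds the input. -/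
structure BagData.Input (E : BagData) (s : Store) : Prop where
  reg0 : s.reg 0 = E.n
  reg1 : s.reg 1 = E.m
  reg2 : s.reg 2 = E.t
  u : ∀ e < E.m, s.word 0 e = E.u e
  v : ∀ e < E.m, s.word 1 e = E.v e
  adj : ∀ x < E.t, ∀ y < E.t, s.word 2 (x * E.t + y) = if E.adj x y then 1 else 0
  bag : ∀ x < E.t, ∀ v < E.n, s.word 3 (x * E.n + v) = if v ∈ E.bag x then 1 else 0

/-- The program does not write the cells of the input. -/
def Program.Safe (p : Program) : Prop :=
  (0 ∉ p.regs ∧ 1 ∉ p.regs ∧ 2 ∉ p.regs) ∧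
    (0 ∉ p.words ∧ 1 ∉ p.words ∧ 2 ∉ p.words ∧ 3 ∉ p.words)

instance (p : Program) : Decidable p.Safe := by unfold Program.Safe; infer_instance

namespace BagData

variable {E : BagData} {s s' : Store}

theorem Input.frame {p : Program} (h : E.Input s) (hF : Frame p s s') (hp : p.Safe) :
    E.Input s' := by
  obtain ⟨⟨r0, r1, r2⟩, w0, w1, w2, w3⟩ := hp
  constructor
  · rw [hF.reg 0 r0, h.reg0]
  · rw [hF.reg 1 r1, h.reg1]
  · rw [hF.reg 2 r2, h.reg2]
  · rw [hF.word 0 w0]; exact h.u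
  · rw [hF.word 1 w1]; exact h.v
  · rw [hF.word 2 w2]; exact h.adj
  · rw [hF.word 3 w3]; exact h.bag

theorem Input.setReg (h : E.Input s) {r x : ℕ} (hr : 2 < r) : E.Input (s.setReg r x) := by
  constructor
  · rw [Store.setReg_reg, if_neg (by omega), h.reg0]
  · rw [Store.setReg_reg, if_neg (by omega), h.reg1]
  · rw [Store.setReg_reg, if_neg (by omega), h.reg2]
  · exact h.u
  · exact h.v
  · exact h.adj
  · exact h.bag

theorem Input.setNum (h : E.Input s) (k i : ℕ) (z : ℂ) : E.Input (s.setNum k i z) :=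
  ⟨h.reg0, h.reg1, h.reg2, h.u, h.v, h.adj, h.bag⟩

theorem Input.setWord (h : E.Input s) {k i x : ℕ} (hk : 3 < k) : E.Input (s.setWord k i x) := by
  refine ⟨h.reg0, h.reg1, h.reg2, ?_, ?_, ?_, ?_⟩ <;> simp only [Store.setWord_word]
  · simpa [show 0 ≠ k by omega] using h.u
  · simpa [show 1 ≠ k by omega] using h.v
  · simpa [show 2 ≠ k by omega] using h.adj
  · simpa [show 3 ≠ k by omega] using h.bag

/-! ### Bounds that exclude overflow, and addresses of pairs -/

variable (E) in
theorem K_lt : E.K < 2 ^ E.w :=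
  lt_of_le_of_lt (Nat.le_mul_of_pos_right _ E.t_pos) E.K_mul_lt

variable (E) in
theorem t_lt : E.t < 2 ^ E.w :=
  lt_of_le_of_lt (Nat.le_mul_of_pos_right _ E.t_pos) E.t_mul_t_lt

variable (E) in
theorem count_pow_le (x : ℕ) {k : ℕ} (hk : k ≤ E.n) : 2 ^ Nat.count (· ∈ E.bag x) k ≤ E.K :=
  (Nat.pow_le_pow_right (by norm_num) (Nat.count_monotone _ hk)).trans (E.pow_le x)

variable (E) in
theorem count_pow_lt (x : ℕ) {k : ℕ} (hk : k ≤ E.n) :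
    2 ^ Nat.count (· ∈ E.bag x) k < 2 ^ E.w :=
  (E.count_pow_le x hk).trans_lt E.K_lt

variable (E) in
/-- The number of entries of the table of a node. -/
def size (x : ℕ) : ℕ := 2 ^ Nat.count (· ∈ E.bag x) E.n

variable (E) in
theorem size_le (x : ℕ) : E.size x ≤ E.K := E.pow_le x

variable (E) in
theorem size_lt (x : ℕ) : E.size x < 2 ^ E.w := E.count_pow_lt x le_rfl

theorem mul_add_lt {a b c d : ℕ} (ha : a < c) (hb : b < d) : a * d + b < c * d := by
  have := Nat.mul_le_mul_right d (Nat.succ_le_of_lt ha)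
  rw [Nat.succ_mul] at this
  omega

/-- Distinct pairs have distinct addresses: a write to one table entry leaves all others alone, and
the input matrices can be read off their rows. -/
theorem mul_add_inj {a b a' b' d : ℕ} (hb : b < d) (hb' : b' < d) :
    a * d + b = a' * d + b' ↔ a = a' ∧ b = b' := by
  constructor
  · intro h
    have h1 := congrArg (· / d) h
    have h2 := congrArg (· % d) h
    have hd : 0 < d := by omega
    simp only [mul_comm _ d, Nat.mul_add_div hd, Nat.div_eq_of_lt hb, Nat.div_eq_of_lt hb',
      Nat.mul_add_mod, Nat.mod_eq_of_lt hb, Nat.mod_eq_of_lt hb', add_zero] at h1 h2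
    exact ⟨h1, h2⟩
  · rintro ⟨rfl, rfl⟩; rfl

/-- Whether the vertex `v` lies in the bag of `x`. -/
def memExpr (x v : WordExpr) : WordExpr := .load 3 (.op .add (.op .mul x (.reg 0)) v)

/-- The address of entry `i` of the table of `x`. -/
def cellExpr (i x : WordExpr) : WordExpr := .op .add (.op .mul i (.reg 2)) x

open Classical in
theorem Input.eval_mem (h : E.Input s) {ex ev : WordExpr} {x v : ℕ} (hx : ex.eval E.w s = x)
    (hv : ev.eval E.w s = v) (hxt : x < E.t) (hvn : v < E.n) :
    (memExpr ex ev).eval E.w s = if v ∈ E.bag x then 1 else 0 := by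
  have hlt := mul_add_lt hxt hvn
  have := E.t_mul_n_lt
  rw [← h.bag x hxt v hvn, memExpr, WordExpr.eval]
  rw [eval_add (eval_mul hx (eval_reg h.reg0) (by omega)) hv (by omega)]

theorem Input.eval_cell (h : E.Input s) {ei ex : WordExpr} {i x : ℕ} (hi : ei.eval E.w s = i)
    (hx : ex.eval E.w s = x) (hiK : i < E.K) (hxt : x < E.t) :
    (cellExpr ei ex).eval E.w s = i * E.t + x := by
  have hlt := mul_add_lt hiK hxt
  have := E.K_mul_lt
  rw [cellExpr, eval_add (eval_mul hi (eval_reg h.reg2) (by omega)) hx (by omega)]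

/-! ### Subroutines -/

/-- `reg 12 := 2 ^ r`, where `r` is the number of vertices below `reg 11` in the bag of `reg 10`. -/
def powProg : Program :=
  .seq (.setReg 12 (.const 1)) (forLoop 13 11 (.setReg 12
    (.op .add (.reg 12) (.op .mul (.reg 12) (memExpr (.reg 10) (.reg 13))))))

/-- The register is doubled at each vertex of the bag, by adding itself times the membership bit. -/
theorem runs_pow (h : E.Input s) {x k : ℕ} (hx : s.reg 10 = x) (hk : s.reg 11 = k) (hxt : x < E.t)
    (hkn : k ≤ E.n) :
    Runs E.w powProg s (k * 19 + 8) fun s' => s'.reg 12 = 2 ^ Nat.count (· ∈ E.bag x) k := by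
  classical
  have h4 := E.four_lt
  have hn := E.n_lt
  have hloop : Runs E.w _ (s.setReg 12 1) _ _ :=
    Runs.forLoop (r := 13) (b := 11) (p := .setReg 12
      (.op .add (.reg 12) (.op .mul (.reg 12) (memExpr (.reg 10) (.reg 13)))))
      (fun i s' => s'.reg 12 = 2 ^ Nat.count (· ∈ E.bag x) i) (N := k) (c := 11)
      (by simp [hk]) (by omega) (by decide) (by decide) (by decide)
      (by intro i s x h; simpa using h) (by simp) (by
        intro i s' hi hr hI hF
        have hin : E.Input s' := (h.setReg (by omega)).frame hF (by decide)
        have h10 : s'.reg 10 = x := by rw [hF.reg 10 (by decide)]; simp [hx]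
        refine Runs.weaken (by decide) (Runs.setReg ?_)
        have hp := E.count_pow_lt x (k := i + 1) (by omega)
        have hp' := E.count_pow_lt x (k := i) (by omega)
        have hc : 2 ^ Nat.count (· ∈ E.bag x) i + (if i ∈ E.bag x
            then 2 ^ Nat.count (· ∈ E.bag x) i else 0) = 2 ^ Nat.count (· ∈ E.bag x) (i + 1) := by
          rw [Nat.count_succ]; split_ifs
          · rw [pow_succ]; omega
          · simp
        rw [eval_add (eval_reg hI) (eval_mul_ite _ (eval_reg hI) (hin.eval_mem (eval_reg h10)
          (eval_reg hr) hxt (by omega)) hp')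
          (by omega), hc]
        simp)
  have h1 : (WordExpr.const 1).eval E.w s = 1 := eval_const (by omega)
  refine Runs.weaken ?_ (Runs.setReg_seq (by rw [h1]; exact hloop))
  simp only [WordExpr.cost]; omega

/-- `reg 12` becomes the size of the table of `reg 10`. -/
def sizeProg : Program := .seq (.setReg 11 (.reg 0)) powProg

theorem runs_size (h : E.Input s) {x : ℕ} (hx : s.reg 10 = x) (hxt : x < E.t) :
    Runs E.w sizeProg s (E.n * 19 + 10) fun s' => s'.reg 12 = E.size x :=
  Runs.weaken (by simp only [WordExpr.cost]; omega)
    (Runs.setReg_seq (runs_pow (h.setReg (by omega)) (by simpa using hx)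
      (by simpa [WordExpr.eval] using h.reg0) hxt le_rfl))

/-- The number, in the bag of `P`, of the intersection of the bag of `X` with the subset of the bag
of `Y` that has the number `i`. -/
def restrict (E : BagData) (Y X P i : ℕ) : ℕ :=
  enc (E.bag P) (dec (E.bag Y) i E.n ∩ E.bag X) E.n

theorem restrict_lt (Y X P i : ℕ) : E.restrict Y X P i < E.size P := enc_lt _ _ _

/-- Treat the vertex `reg 27` in the computation of `restrict`. -/
def restrictBody : Program :=
  .seq (.setReg 24 (.op .add (.reg 24) (.op .mul (.reg 26)
      (.op .mul (.op .mul (memExpr (.reg 21) (.reg 27)) (memExpr (.reg 22) (.reg 27)))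
        (.op .mul (memExpr (.reg 20) (.reg 27)) (bitExpr (.reg 23) (.reg 25)))))))
  (.seq (.setReg 25 (.op .add (.reg 25) (.op .mul (.reg 25) (memExpr (.reg 20) (.reg 27)))))
  (.setReg 26 (.op .add (.reg 26) (.op .mul (.reg 26) (memExpr (.reg 22) (.reg 27))))))

/-- `reg 24 := restrict (reg 20) (reg 21) (reg 22) (reg 23)` -/
def restrictProg : Program :=
  .seq (.setReg 24 (.const 0)) (.seq (.setReg 25 (.const 1)) (.seq (.setReg 26 (.const 1))
    (forLoop 27 0 restrictBody)))

/-- One pass over the vertices. Registers 25 and 26 hold the powers of two that belong to the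
current vertex in the bags of `Y` and `P`; a digit is copied from the first numbering to the second
exactly when the vertex lies in all three bags. -/
theorem runs_restrict (h : E.Input s) {Y X P i : ℕ} (hY : s.reg 20 = Y) (hX : s.reg 21 = X)
    (hP : s.reg 22 = P) (hi : s.reg 23 = i) (hYt : Y < E.t) (hXt : X < E.t) (hPt : P < E.t)
    (hiK : i < E.K) :
    Runs E.w restrictProg s (E.n * 70 + 20) fun s' => s'.reg 24 = E.restrict Y X P i := by
  classical
  have h4 := E.four_lt
  have hn := E.n_lt
  have hK := E.K_lt
  have hc : ∀ x k, 2 ^ Nat.count (· ∈ E.bag x) k + (if k ∈ E.bag x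
      then 2 ^ Nat.count (· ∈ E.bag x) k else 0) = 2 ^ Nat.count (· ∈ E.bag x) (k + 1) := by
    intro x k
    rw [Nat.count_succ]; split_ifs
    · rw [pow_succ]; omega
    · simp
  have e0 : ∀ s, (WordExpr.const 0).eval E.w s = 0 := fun _ => eval_const (by omega)
  have e1 : ∀ s, (WordExpr.const 1).eval E.w s = 1 := fun _ => eval_const (by omega)
  refine Runs.mono (Runs.setReg_seq (Runs.setReg_seq (Runs.setReg_seq
    (Runs.forLoop (r := 27) (b := 0) (p := restrictBody)
      (fun k s' => s'.reg 24 = enc (E.bag P) (dec (E.bag Y) i E.n ∩ E.bag X) k ∧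
        s'.reg 25 = 2 ^ Nat.count (· ∈ E.bag Y) k ∧ s'.reg 26 = 2 ^ Nat.count (· ∈ E.bag P) k)
      (N := E.n) (c := 60) (by simp [h.reg0]) hn (by decide) (by decide) (by decide)
      (by intro i s x h; simpa using h) (by simp [e0, e1, enc]) ?_)))) ?_ fun s' h _ => h.1
  rotate_left
  · simp only [WordExpr.cost]; omega
  intro k s' hk hr ⟨hJ, hPY, hPP⟩ hF
  have hin : E.Input s' :=
    (((h.setReg (by omega)).setReg (by omega)).setReg (by omega)).frame hF (by decide)
  have h20 : s'.reg 20 = Y := by rw [hF.reg 20 (by decide)]; simp [hY]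
  have h21 : s'.reg 21 = X := by rw [hF.reg 21 (by decide)]; simp [hX]
  have h22 : s'.reg 22 = P := by rw [hF.reg 22 (by decide)]; simp [hP]
  have h23 : s'.reg 23 = i := by rw [hF.reg 23 (by decide)]; simp [hi]
  have hpY := E.count_pow_lt Y (k := k) (by omega)
  have hpP := E.count_pow_lt P (k := k) (by omega)
  have hpY' := E.count_pow_lt Y (k := k + 1) (by omega)
  have hpP' := E.count_pow_lt P (k := k + 1) (by omega)
  set A := dec (E.bag Y) i E.n ∩ E.bag X with hA
  have hsucc : enc (E.bag P) A (k + 1) = enc (E.bag P) A k + if (k ∈ E.bag X ∧ k ∈ E.bag P) ∧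
      k ∈ E.bag Y ∧ i / 2 ^ Nat.count (· ∈ E.bag Y) k % 2 = 1
      then 2 ^ Nat.count (· ∈ E.bag P) k else 0 := by
    rw [enc]
    congr 1
    refine if_congr ?_ rfl rfl
    rw [hA, Finset.mem_inter]
    by_cases hkY : k ∈ E.bag Y
    · rw [mem_dec_iff hk hkY]; tauto
    · have : k ∉ dec (E.bag Y) i E.n := fun h => hkY (dec_subset _ _ _ h)
      tauto
  have hlt : enc (E.bag P) A (k + 1) < 2 ^ E.w := (enc_lt _ _ _).trans hpP'
  have ev1 : WordExpr.eval E.w s' (.op .add (.reg 24) (.op .mul (.reg 26)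
      (.op .mul (.op .mul (memExpr (.reg 21) (.reg 27)) (memExpr (.reg 22) (.reg 27)))
        (.op .mul (memExpr (.reg 20) (.reg 27)) (bitExpr (.reg 23) (.reg 25)))))) =
      enc (E.bag P) A (k + 1) := by
    rw [hsucc] at hlt ⊢
    exact eval_add (eval_reg hJ) (eval_mul_ite _ (eval_reg hPP) (eval_and _ _ (by omega)
      (eval_and _ _ (by omega) (hin.eval_mem (eval_reg h21) (eval_reg hr) hXt hk) (hin.eval_mem (eval_reg h22) (eval_reg hr) hPt hk))
      (eval_and _ _ (by omega) (hin.eval_mem (eval_reg h20) (eval_reg hr) hYt hk)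
        (eval_bit (by omega) (eval_reg h23) (eval_reg hPY) (by omega)))) hpP) hlt
  refine Runs.weaken (by decide) (Runs.setReg_seq (Runs.setReg_seq (Runs.setReg ?_)))
  have hin1 := hin.setReg (r := 24) (x := enc (E.bag P) A (k + 1)) (by omega)
  have hin2 := hin1.setReg (r := 25) (x := 2 ^ Nat.count (· ∈ E.bag Y) (k + 1)) (by omega)
  rw [ev1, eval_add (x := 2 ^ Nat.count (· ∈ E.bag Y) k) (eval_reg (by simpa using hPY))
      (eval_mul_ite _ (eval_reg (by simpa using hPY))
        (hin1.eval_mem (x := Y) (eval_reg (by simpa using h20))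
          (eval_reg (by simpa using hr)) hYt hk) hpY) (by rw [hc]; exact hpY'), hc,
    eval_add (x := 2 ^ Nat.count (· ∈ E.bag P) k) (eval_reg (by simpa using hPP))
      (eval_mul_ite _ (eval_reg (by simpa using hPP))
        (hin2.eval_mem (x := P) (eval_reg (by simpa using h22))
          (eval_reg (by simpa using hr)) hPt hk) hpP) (by rw [hc]; exact hpP'), hc]
  simp

/-! ### Tables -/

/-- Entry `reg ri` of the table of `reg rx`. -/
def tableExpr (ri rx : ℕ) : NumExpr := .load 2 (cellExpr (.reg ri) (.reg rx))

theorem Input.eval_table (h : E.Input s) {ri rx i x : ℕ} (hi : s.reg ri = i) (hx : s.reg rx = x)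
    (hiK : i < E.K) (hxt : x < E.t) : (tableExpr ri rx).eval E.w s = s.num 2 (i * E.t + x) := by
  rw [tableExpr, NumExpr.eval, h.eval_cell (eval_reg hi) (eval_reg hx) hiK hxt]

/-- Overwrite the entries of the table of `reg rx` one after the other by values of `f`. -/
def tableLoop (ri b rx : ℕ) (pre : Program) (f : NumExpr) : Program :=
  forLoop ri b (.seq pre (.setNum 2 (cellExpr (.reg ri) (.reg rx)) f))

/-- Round `i` writes only entry `i`, so `hpre` may assume that this entry still has its old value;
`f` can therefore update the table in place. -/
theorem runs_tableLoop {ri b rx : ℕ} {pre : Program} {f : NumExpr} (h : E.Input s) {x N c : ℕ}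
    (hb : s.reg b = N) (hx : s.reg rx = x) (hNK : N ≤ E.K) (hxt : x < E.t) (g : ℕ → ℂ)
    (hri : ri ∉ pre.regs) (hbp : b ∉ pre.regs) (hrx : rx ∉ pre.regs) (hbri : b ≠ ri)
    (hrxi : rx ≠ ri) (hsafe : pre.Safe) (h2ri : 2 < ri) (h2 : 2 ∉ pre.nums)
    (hpre : ∀ i s', i < N → s'.reg ri = i → s'.num 2 (i * E.t + x) = s.num 2 (i * E.t + x) →
      Frame (tableLoop ri b rx pre f) s s' → E.Input s' →
      Runs E.w pre s' c fun s'' => f.eval E.w s'' = g i) :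
    Runs E.w (tableLoop ri b rx pre f) s (N * (c + f.cost + 16) + 6) fun s' =>
      ∀ i, ∀ y < E.t,
        s'.num 2 (i * E.t + y) = if y = x ∧ i < N then g i else s.num 2 (i * E.t + y) := by
  have hsafe' : (tableLoop ri b rx pre f).Safe := by
    obtain ⟨⟨r0, r1, r2⟩, w0, w1, w2, w3⟩ := hsafe
    refine ⟨⟨?_, ?_, ?_⟩, ?_, ?_, ?_, ?_⟩ <;>
      simp only [tableLoop, forLoop, Program.regs, Program.words, List.mem_append, List.mem_cons,
        List.not_mem_nil, or_false, false_or, not_or] <;> (try refine ⟨?_, ?_, ?_⟩) <;>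
      first | assumption | omega
  refine Runs.weaken ?_ (Runs.forLoop (c := c + f.cost + 8) (N := N) (fun k s' => ∀ i, ∀ y < E.t,
        s'.num 2 (i * E.t + y) = if y = x ∧ i < k then g i else s.num 2 (i * E.t + y)) hb
      (lt_of_le_of_lt hNK E.K_lt) (by simpa [Program.regs] using hri)
      (by simpa [Program.regs] using hbp) hbri (fun _ _ _ h => h) (by simp) ?_)
  · exact le_rfl
  intro i s' hi hr hI hF
  have hin := h.frame hF hsafe'
  have hK : i < E.K := by omega
  refine Runs.weaken ?_ (Runs.seq (hpre i s' hi hr (by rw [hI i x hxt]; simp) hF hin) ?_)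
    (B₁ := c + ((cellExpr (.reg ri) (.reg rx)).cost + f.cost + 1))
  · simp only [cellExpr, WordExpr.cost]; omega
  intro s'' hs'' hF'
  refine Runs.setNum ?_
  have hx' : s''.reg rx = x := by
    rw [hF'.reg rx hrx, hF.reg rx, hx]
    simp [forLoop, Program.regs, hrx, hrxi]
  rw [hs'', (hin.frame hF' hsafe).eval_cell (eval_reg (by rw [hF'.reg ri hri, hr])) (eval_reg hx')
    hK hxt]
  intro j y hy
  rw [Store.setNum_num, hF'.num 2 h2, hI j y hy]
  simp only [mul_add_inj hy hxt]
  by_cases hyx : y = x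
  · by_cases hji : j = i
    · simp [hyx, hji]
    · have : j < i ↔ j < i + 1 := by omega
      simp [hyx, hji, this]
  · simp [hyx]

/-- Set all tables to one and mark all nodes as present. -/
def initProg : Program :=
  forLoop 30 2 (.seq (.setWord 4 (.reg 30) (.const 1)) (.seq (.setReg 10 (.reg 30))
    (.seq sizeProg (tableLoop 31 12 30 .skip (.ofWord (.const 1))))))

theorem runs_init (h : E.Input s) :
    Runs E.w initProg s (E.t * (E.K * 19 + E.n * 19 + 30) + 6) fun s' => ∀ x < E.t,
      s'.word 4 x = 1 ∧ ∀ i < E.size x, s'.num 2 (i * E.t + x) = 1 := by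
  have h4 := E.four_lt
  refine Runs.weaken ?_ (Runs.forLoop (c := E.K * 19 + E.n * 19 + 22) (N := E.t)
    (fun k s' => ∀ x < k, s'.word 4 x = 1 ∧ ∀ i < E.size x, s'.num 2 (i * E.t + x) = 1)
    h.reg2 E.t_lt (by decide) (by decide) (by decide) (fun _ _ _ h => h) (by simp) ?_)
  · exact le_rfl
  intro x s' hx hr hI hF
  have hin := h.frame hF (by decide)
  have e1 : (WordExpr.const 1).eval E.w s' = 1 := eval_const (by omega)
  have hsz := Nat.mul_le_mul_right 19 (E.size_le x)
  refine Runs.weaken ?_ (Runs.setWord_seq (Runs.setReg_seq (Runs.seq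
    (Q₁ := fun s'' => s''.reg 12 = E.size x) (runs_size ?_ (x := x) ?_ hx) fun s'' hs'' hF' => ?_)))
    (B₁ := 3 + (2 + ((E.n * 19 + 10) + (E.size x * (1 + 2 + 16) + 6))))
  · omega
  · rw [eval_reg hr, e1]
    exact (hin.setWord (by omega)).setReg (by omega)
  · simp [WordExpr.eval, hr]
  · rw [eval_reg hr, e1] at hF'
    have hin' : E.Input s'' := Input.frame
      ((hin.setWord (by omega)).setReg (by omega)) hF' (by decide)
    have h30 : s''.reg 30 = x := by rw [hF'.reg 30 (by decide)]; simpa using hr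
    refine Runs.mono (runs_tableLoop hin' hs'' h30 (E.size_le x) hx (fun _ => 1) (by decide)
      (by decide) (by decide) (by decide) (by decide) (by decide) (by decide) (by decide)
      (c := 1) fun i s₁ _ _ _ _ _ => Runs.skip ?_) le_rfl ?_
    · simp only [NumExpr.eval]
      rw [eval_const (by omega)]
      simp
    · intro s₁ h₁ hF₁ y hy
      have hyt : y < E.t := by omega
      rw [hF₁.word 4 (by decide), hF'.word 4 (by decide)]
      by_cases hyx : y = x
      · subst hyx
        refine ⟨by simp, fun i hi => ?_⟩
        rw [h₁ i y hyt]; simp [hi]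
      · obtain ⟨ha, ht⟩ := hI y (by omega)
        refine ⟨by simpa [hyx] using ha, fun i hi => ?_⟩
        rw [h₁ i y hyt, if_neg (by tauto), hF'.num 2 (by decide)]
        exact ht i hi

/-- The entry of the table of `x` for the subset `A`. -/
def tbl (E : BagData) (s : Store) (x : ℕ) (A : Finset ℕ) : ℂ :=
  s.num 2 (enc (E.bag x) A E.n * E.t + x)

open Classical in
/-- The weight of the edge `e` for the vertex set `A`. -/
noncomputable def weight (E : BagData) (p q : ℂ) (e : ℕ) (A : Finset ℕ) : ℂ :=
  if E.u e ∈ A ↔ E.v e ∈ A then p else q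

/-- `reg 33` becomes a node whose bag contains both ends of the edge `reg 32`. -/
def findProg : Program :=
  forLoop 34 2 (.ite (.op .mul (memExpr (.reg 34) (.load 0 (.reg 32)))
    (memExpr (.reg 34) (.load 1 (.reg 32)))) (.setReg 33 (.reg 34)) .skip)

theorem runs_find (h : E.Input s) {e : ℕ} (he : s.reg 32 = e) (hem : e < E.m) :
    Runs E.w findProg s (E.t * 26 + 6) fun s' => s'.reg 33 < E.t ∧
      E.u e ∈ E.bag (s'.reg 33) ∧ E.v e ∈ E.bag (s'.reg 33) := by
  classical
  have h4 := E.four_lt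
  refine Runs.mono (Runs.forLoop (c := 18) (N := E.t)
    -- Nothing is claimed before the first match, and later matches overwrite earlier ones;
    -- `E.edge_mem` provides a match.
    (fun k s' => (∃ x < k, E.u e ∈ E.bag x ∧ E.v e ∈ E.bag x) → s'.reg 33 < E.t ∧
      E.u e ∈ E.bag (s'.reg 33) ∧ E.v e ∈ E.bag (s'.reg 33))
    h.reg2 E.t_lt (by decide) (by decide) (by decide) (fun _ _ _ h => by simpa using h)
    (by simp) ?_) le_rfl fun s' h' _ => h' (E.edge_mem e hem)
  intro x s' hx hr hI hF
  have hin := h.frame hF (by decide)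
  have h32 : s'.reg 32 = e := by rw [hF.reg 32 (by decide), he]
  have hu : (WordExpr.load 0 (.reg 32)).eval E.w s' = E.u e := by
    simp only [WordExpr.eval, h32, hin.u e hem]
  have hv : (WordExpr.load 1 (.reg 32)).eval E.w s' = E.v e := by
    simp only [WordExpr.eval, h32, hin.v e hem]
  have hev := eval_and _ _ (by omega) (hin.eval_mem (eval_reg hr) hu hx (E.u_lt e hem))
    (hin.eval_mem (eval_reg hr) hv hx (E.v_lt e hem))
  refine Runs.weaken (by decide) (Runs.ite (B := 2) ?_ ?_)
  · intro hne
    rw [hev] at hne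
    have hc : E.u e ∈ E.bag x ∧ E.v e ∈ E.bag x := by
      by_contra hc; exact hne (if_neg hc)
    refine Runs.setReg fun _ => ?_
    simpa [WordExpr.eval, hr, hx] using hc
  · intro h0
    rw [hev] at h0
    have hc : ¬ (E.u e ∈ E.bag x ∧ E.v e ∈ E.bag x) := by
      intro hc; simp [hc] at h0
    refine Runs.weaken (by decide) (Runs.skip ?_)
    rintro ⟨y, hy, hyc⟩
    refine hI ⟨y, ?_, hyc⟩
    rcases Nat.lt_succ_iff_lt_or_eq.1 hy with h | rfl
    · exact h
    · exact absurd hyc hc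

/-- Multiply a table by the weights of the edge `reg 32`. -/
def edgeBody : Program :=
  .seq findProg (.seq (.setReg 10 (.reg 33)) (.seq (.setReg 11 (.load 0 (.reg 32))) (.seq powProg
    (.seq (.setReg 35 (.reg 12)) (.seq (.setReg 11 (.load 1 (.reg 32))) (.seq powProg
      (.seq (.setReg 36 (.reg 12)) (.seq sizeProg
        (tableLoop 37 12 33 .skip (.op .mul (tableExpr 37 33) (.load 4
          (.op .eq (bitExpr (.reg 37) (.reg 35)) (bitExpr (.reg 37) (.reg 36))))))))))))))

/-- The edge is charged to a single node, so its weight enters the product over all nodes once. The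
comparison of the two colour digits gives `1` or `0`, which serves directly as the address of the
weight. -/
theorem runs_edgeBody (h : E.Input s) {e : ℕ} (he : s.reg 32 = e) (hem : e < E.m) {p q : ℂ}
    (hp : s.num 4 1 = p) (hq : s.num 4 0 = q) :
    Runs E.w edgeBody s (E.t * 26 + E.n * 57 + E.K * 40 + 60) fun s' => ∃ x < E.t,
      ∀ y < E.t, ∀ A, E.tbl s' y A =
        E.tbl s y A * if y = x then E.weight p q e A else 1 := by
  classical
  have h4 := E.four_lt
  refine Runs.weaken ?_ (Runs.seq (runs_find h he hem) (B₂ := E.n * 57 + E.K * 40 + 54) ?_)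
  · omega
  rintro s₁ ⟨hxt, hux, hvx⟩ hF₁
  obtain ⟨x, hx⟩ : ∃ x, x = s₁.reg 33 := ⟨_, rfl⟩
  rw [← hx] at hxt hux hvx
  have hin₁ := h.frame hF₁ (by decide)
  have h32 : s₁.reg 32 = e := by rw [hF₁.reg 32 (by decide), he]
  have hu : s₁.word 0 e = E.u e := hin₁.u e hem
  have hv : s₁.word 1 e = E.v e := hin₁.v e hem
  have hun := E.u_lt e hem
  have hvn := E.v_lt e hem
  refine Runs.weaken ?_ (Runs.setReg_seq (Runs.setReg_seq (Runs.seq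
    (runs_pow (x := x) (k := E.u e) ((hin₁.setReg (by omega)).setReg (by omega))
      (by simp [WordExpr.eval, ← hx]) (by simp [WordExpr.eval, h32, hu]) hxt hun.le)
    (B₂ := E.n * 38 + E.K * 40 + 40) ?_)))
  · simp only [WordExpr.cost]; omega
  intro s₂ h12 hF₂
  have hin₂ := Input.frame ((hin₁.setReg (by omega)).setReg (by omega)) hF₂ (by decide)
  have h32₂ : s₂.reg 32 = e := by rw [hF₂.reg 32 (by decide)]; simpa using h32
  have h10₂ : s₂.reg 10 = x := by
    rw [hF₂.reg 10 (by decide)]; simp [WordExpr.eval, ← hx]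
  have h33₂ : s₂.reg 33 = x := by rw [hF₂.reg 33 (by decide)]; simp [← hx]
  have hu₂ : s₂.word 1 e = E.v e := hin₂.v e hem
  refine Runs.weaken ?_ (Runs.setReg_seq (Runs.setReg_seq (Runs.seq
    (runs_pow (x := x) (k := E.v e) ((hin₂.setReg (by omega)).setReg (by omega))
      (by simp [h10₂]) (by simp [WordExpr.eval, h32₂, hu₂]) hxt hvn.le)
    (B₂ := E.n * 19 + E.K * 40 + 20) ?_)))
  · simp only [WordExpr.cost]; omega
  intro s₃ h12₃ hF₃
  have hin₃ := Input.frame ((hin₂.setReg (by omega)).setReg (by omega)) hF₃ (by decide)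
  have h10₃ : s₃.reg 10 = x := by rw [hF₃.reg 10 (by decide)]; simp [h10₂]
  have h33₃ : s₃.reg 33 = x := by rw [hF₃.reg 33 (by decide)]; simp [h33₂]
  have h35₃ : s₃.reg 35 = 2 ^ Nat.count (· ∈ E.bag x) (E.u e) := by
    rw [hF₃.reg 35 (by decide)]; simp [WordExpr.eval, h12]
  refine Runs.weaken ?_ (Runs.setReg_seq (Runs.seq
    (runs_size (x := x) (hin₃.setReg (by omega)) (by simp [h10₃]) hxt)
    (B₂ := E.K * 40 + 8) ?_))
  · simp only [WordExpr.cost]; omega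
  intro s₄ h12₄ hF₄
  have hin₄ := Input.frame (hin₃.setReg (by omega)) hF₄ (by decide)
  have h33₄ : s₄.reg 33 = x := by rw [hF₄.reg 33 (by decide)]; simp [h33₃]
  have h35₄ : s₄.reg 35 = 2 ^ Nat.count (· ∈ E.bag x) (E.u e) := by
    rw [hF₄.reg 35 (by decide)]; simp [h35₃]
  have h36₄ : s₄.reg 36 = 2 ^ Nat.count (· ∈ E.bag x) (E.v e) := by
    rw [hF₄.reg 36 (by decide)]; simp [WordExpr.eval, h12₃]
  have hnum : ∀ k, s₄.num k = s.num k := fun k => by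
    rw [hF₄.num k (by simp [sizeProg, powProg, forLoop, Program.nums]), Store.setReg_num,
      hF₃.num k (by simp [powProg, forLoop, Program.nums]), Store.setReg_num, Store.setReg_num,
      hF₂.num k (by simp [powProg, forLoop, Program.nums]), Store.setReg_num, Store.setReg_num,
      hF₁.num k (by simp [findProg, forLoop, Program.nums])]
  refine Runs.mono (runs_tableLoop hin₄ h12₄ h33₄ (E.size_le x) hxt
    (fun i => s.num 2 (i * E.t + x) * if (i / 2 ^ Nat.count (· ∈ E.bag x) (E.u e) % 2 = 1 ↔
      i / 2 ^ Nat.count (· ∈ E.bag x) (E.v e) % 2 = 1) then p else q) (by decide)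
      (by decide) (by decide) (by decide) (by decide) (by decide) (by decide) (by decide)
      (c := 1) fun i s₅ hi hr hi2 hF₅ hin₅ => Runs.skip ?_) ?_ ?_
  · have hiK : i < E.K := lt_of_lt_of_le hi (E.size_le x)
    have hiw := E.K_lt
    have h33 : s₅.reg 33 = x := by rw [hF₅.reg 33 (by decide), h33₄]
    have h35 := (hF₅.reg 35 (by decide)).trans h35₄
    have h36 := (hF₅.reg 36 (by decide)).trans h36₄
    simp only [NumExpr.eval, NumOp.eval]
    rw [hin₅.eval_table hr h33 hiK hxt, hi2, hnum, eval_eq (by omega)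
      (eval_bit (by omega) (eval_reg hr) (eval_reg h35) (by omega))
      (eval_bit (by omega) (eval_reg hr) (eval_reg h36) (by omega)), hF₅.num 4 (by decide), hnum]
    congr 1
    rw [← hp, ← hq]
    split_ifs <;> simp_all
  · simp only [NumExpr.cost, WordExpr.cost, tableExpr, cellExpr, bitExpr]
    have := Nat.mul_le_mul_right 40 (E.size_le x)
    omega
  · intro s₅ h₅ _
    refine ⟨x, hxt, fun y hy A => ?_⟩
    rw [tbl, tbl, h₅ _ y hy, hnum]
    by_cases hyx : y = x
    · subst hyx
      rw [if_pos ⟨rfl, enc_lt _ _ _⟩, if_pos rfl, weight]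
      congr 1
      refine if_congr ?_ rfl rfl
      have := testBit_enc (E.bag y) A hun hux
      have h' := testBit_enc (E.bag y) A hvn hvx
      rw [Nat.testBit_eq_decide_div_mod_eq, decide_eq_decide] at this h'
      rw [this, h']
    · rw [if_neg (by tauto), if_neg hyx, mul_one]

/-- Multiply the tables by the weights of the edges. -/
def edgesProg : Program := forLoop 32 1 edgeBody

theorem runs_edges (h : E.Input s) {p q : ℂ} (hp : s.num 4 1 = p) (hq : s.num 4 0 = q)
    (h1 : ∀ x < E.t, ∀ A, E.tbl s x A = 1) :
    Runs E.w edgesProg s (E.m * (E.t * 26 + E.n * 57 + E.K * 40 + 68) + 6) fun s' => ∀ A,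
      ∏ x ∈ Finset.range E.t, E.tbl s' x A = ∏ e ∈ Finset.range E.m, E.weight p q e A := by
  refine Runs.weaken ?_ (Runs.forLoop (c := E.t * 26 + E.n * 57 + E.K * 40 + 60) (N := E.m)
    (fun k s' => ∀ A, ∏ x ∈ Finset.range E.t, E.tbl s' x A =
      ∏ e ∈ Finset.range k, E.weight p q e A)
    h.reg1 E.m_lt (by decide) (by decide) (by decide) (fun _ _ _ h => h) ?_ ?_)
  · exact le_rfl
  · intro A
    rw [Finset.range_zero, Finset.prod_empty]
    exact Finset.prod_eq_one fun x hx => h1 x (Finset.mem_range.1 hx) A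
  intro e s' he hr hI hF
  have hin := h.frame hF (by decide)
  refine Runs.mono (runs_edgeBody hin hr he ((congrFun (hF.num 4 (by decide)) 1).trans hp)
    ((congrFun (hF.num 4 (by decide)) 0).trans hq)) le_rfl ?_
  rintro s₁ ⟨x, hx, h₁⟩ _ A
  rw [Finset.prod_range_succ, ← hI A,
    Finset.prod_congr rfl fun y hy => h₁ y (Finset.mem_range.1 hy) A, Finset.prod_mul_distrib]
  congr 1
  rw [Finset.prod_ite_eq', if_pos (Finset.mem_range.2 hx)]

/-! ### Eliminating a leaf -/

/-- Store the message of `reg 21` to `reg 22` in number array `3`. -/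
def messageProg : Program :=
  .seq (forLoop 41 40 (.setNum 3 (.reg 41) (.ofWord (.const 0)))) (.seq (.setReg 20 (.reg 21))
    (forLoop 23 12 (.seq restrictProg (.setNum 3 (.reg 24)
      (.op .add (.load 3 (.reg 24)) (tableExpr 23 21))))))

/-- Each entry of the table of `x` is added to the cell of its trace on the bag of `p`. No pair of
entries is inspected, so the time is linear in the table size; this gives `2^tw` instead of `4^tw`.
-/
theorem runs_message (h : E.Input s) {x p : ℕ} (hx : s.reg 21 = x) (hp : s.reg 22 = p)
    (hxt : x < E.t) (hpt : p < E.t) (h12 : s.reg 12 = E.size x) (h40 : s.reg 40 = E.size p) :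
    Runs E.w messageProg s (E.K * (E.n * 70 + 60) + 20) fun s' => ∀ j < E.size p,
      s'.num 3 j = ∑ i ∈ Finset.range (E.size x),
        if E.restrict x x p i = j then s.num 2 (i * E.t + x) else 0 := by
  have h4 := E.four_lt
  -- The array is cleared because it may hold an earlier message.
  refine Runs.weaken ?_ (Runs.seq (Runs.forLoop (c := 5) (N := E.size p)
    (fun k s' => ∀ j < k, s'.num 3 j = 0) h40 (E.size_lt p) (by decide) (by decide) (by decide)
    (fun _ _ _ h => h) (by simp) ?_) (B₂ := 2 + (E.size x * (E.n * 70 + 20 + 18 + 8) + 6)) ?_)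
  · have h1 := E.size_le p
    have h2 := Nat.mul_le_mul_right (E.n * 70) (E.size_le x)
    have h3 := E.size_le x
    simp only [mul_add] at *
    omega
  · intro j s' hj hr hI hF
    refine Runs.weaken (by decide) (Runs.setNum ?_)
    intro i hi
    have e0 : (WordExpr.const 0).eval E.w s' = 0 := eval_const (by omega)
    rw [Store.setNum_num, eval_reg hr, NumExpr.eval, e0]
    split_ifs with hc
    · simp
    · exact hI i (by omega)
  intro s₁ h0 hF₁
  have hin₁ := h.frame hF₁ (by decide)
  have hx₁ : s₁.reg 21 = x := by rw [hF₁.reg 21 (by decide), hx]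
  have hp₁ : s₁.reg 22 = p := by rw [hF₁.reg 22 (by decide), hp]
  refine Runs.setReg_seq (Runs.forLoop (N := E.size x)
    (fun k s' => ∀ j < E.size p, s'.num 3 j = ∑ i ∈ Finset.range k,
        if E.restrict x x p i = j then s.num 2 (i * E.t + x) else 0)
    (by simp [hF₁.reg 12 (by decide), h12]) (E.size_lt x) (by decide) (by decide) (by decide)
    (fun _ _ _ h => h) (by simpa using h0) ?_)
  intro i s₂ hi hr hI hF
  have hin₂ := (hin₁.setReg (by omega)).frame hF (by decide)
  have hiK : i < E.K := lt_of_lt_of_le hi (E.size_le x)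
  have h20 : s₂.reg 20 = x := by rw [hF.reg 20 (by decide)]; simp [WordExpr.eval, hx₁]
  have h21 : s₂.reg 21 = x := by rw [hF.reg 21 (by decide)]; simp [hx₁]
  have h22 : s₂.reg 22 = p := by rw [hF.reg 22 (by decide)]; simp [hp₁]
  refine Runs.weaken ?_ (Runs.seq (runs_restrict hin₂ h20 h21 h22 hr hxt hxt hpt hiK)
    fun s₃ h₃ hF₃ => Runs.setNum fun j hj => ?_)
  · simp only [WordExpr.cost, NumExpr.cost, tableExpr, cellExpr]; omega
  have hin₃ := hin₂.frame hF₃ (by decide)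
  rw [Store.setNum_num, eval_reg h₃, Finset.sum_range_succ, ← hI j hj]
  simp only [NumExpr.eval, NumOp.eval]
  rw [hin₃.eval_table (by rw [hF₃.reg 23 (by decide), hr]) (by rw [hF₃.reg 21 (by decide), h21])
    hiK hxt, eval_reg h₃, hF₃.num 3 (by decide), hF₃.num 2 (by decide), hF.num 2 (by decide),
    Store.setReg_num, hF₁.num 2 (by decide)]
  by_cases hj' : j = E.restrict x x p i
  · simp [hj']
  · simp [hj', Ne.symm hj']

/-- Multiply the table of `reg 22` by the message in number array `3`. -/
def absorbProg : Program :=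
  .seq (.setReg 20 (.reg 22))
    (tableLoop 23 40 22 restrictProg (.op .mul (tableExpr 23 22) (.load 3 (.reg 24))))

/-- A subset `A` of the bag of `p` looks up the cell of `A ∩ bag x`. This cell is numbered in the
bag of `p`, as in the message, so the two sides agree without a separate numbering of the
intersection. -/
theorem runs_absorb (h : E.Input s) {x p : ℕ} (hx : s.reg 21 = x) (hp : s.reg 22 = p)
    (hxt : x < E.t) (hpt : p < E.t) (h40 : s.reg 40 = E.size p) :
    Runs E.w absorbProg s (E.K * (E.n * 70 + 60) + 20) fun s' => ∀ i, ∀ y < E.t,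
      s'.num 2 (i * E.t + y) = if y = p ∧ i < E.size p
        then s.num 2 (i * E.t + p) * s.num 3 (E.restrict p x p i)
        else s.num 2 (i * E.t + y) := by
  refine Runs.weaken ?_ (Runs.setReg_seq (runs_tableLoop (h.setReg (by omega)) (x := p)
    (N := E.size p) (c := E.n * 70 + 20) (by simp [h40]) (by simp [hp]) (E.size_le p) hpt
    (fun i => s.num 2 (i * E.t + p) * s.num 3 (E.restrict p x p i)) (by decide)
    (by decide) (by decide) (by decide) (by decide) (by decide) (by decide) (by decide) ?_))
  · have h2 := Nat.mul_le_mul_right (E.n * 70) (E.size_le p)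
    have h3 := E.size_le p
    simp only [WordExpr.cost, NumExpr.cost, tableExpr, cellExpr, mul_add] at *
    omega
  intro i s₂ hi hr hI hF hin₂
  have hiK : i < E.K := lt_of_lt_of_le hi (E.size_le p)
  have h20 : s₂.reg 20 = p := by rw [hF.reg 20 (by decide)]; simp [WordExpr.eval, hp]
  have h21 : s₂.reg 21 = x := by rw [hF.reg 21 (by decide)]; simp [hx]
  have h22 : s₂.reg 22 = p := by rw [hF.reg 22 (by decide)]; simp [hp]
  refine Runs.mono (runs_restrict hin₂ h20 h21 h22 hr hpt hxt hpt hiK) le_rfl fun s₃ h₃ hF₃ => ?_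
  have hin₃ := hin₂.frame hF₃ (by decide)
  simp only [NumExpr.eval, NumOp.eval]
  rw [hin₃.eval_table (by rw [hF₃.reg 23 (by decide), hr]) (by rw [hF₃.reg 22 (by decide), h22])
    hiK hpt, eval_reg h₃, hF₃.num 2 (by decide), hI, hF₃.num 3 (by decide), hF.num 3 (by decide)]
  rfl

/-- Eliminate the node `reg 21`, whose only remaining neighbour is `reg 22`. -/
def elimProg : Program :=
  .seq (.setReg 10 (.reg 22)) (.seq sizeProg (.seq (.setReg 40 (.reg 12))
    (.seq (.setReg 10 (.reg 21)) (.seq sizeProg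
      (.seq messageProg (.seq absorbProg (.setWord 4 (.reg 21) (.const 0))))))))

theorem runs_elim (h : E.Input s) {x p : ℕ} (hx : s.reg 21 = x) (hp : s.reg 22 = p)
    (hxt : x < E.t) (hpt : p < E.t) :
    Runs E.w elimProg s (E.K * (E.n * 140 + 120) + E.n * 38 + 80) fun s' =>
      (∀ z, s'.word 4 z = if z = x then 0 else s.word 4 z) ∧ ∀ i, ∀ y < E.t,
      s'.num 2 (i * E.t + y) = if y = p ∧ i < E.size p
        then s.num 2 (i * E.t + p) * ∑ i' ∈ Finset.range (E.size x),
          (if E.restrict x x p i' = E.restrict p x p i then s.num 2 (i' * E.t + x) else 0)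
        else s.num 2 (i * E.t + y) := by
  have h4 := E.four_lt
  refine Runs.weaken ?_ (Runs.setReg_seq (Runs.seq (runs_size (x := p) (h.setReg (by omega))
    (by simp [WordExpr.eval, hp]) hpt)
    (B₂ := E.K * (E.n * 140 + 120) + E.n * 19 + 60) fun s₁ h₁ hF₁ => ?_))
  · simp only [WordExpr.cost]; omega
  have hin₁ := (h.setReg (by omega)).frame hF₁ (by decide)
  have hx₁ : s₁.reg 21 = x := by rw [hF₁.reg 21 (by decide)]; simp [hx]
  refine Runs.weaken ?_ (Runs.setReg_seq (Runs.setReg_seq (Runs.seq (runs_size (x := x)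
    ((hin₁.setReg (by omega)).setReg (by omega)) (by simp [WordExpr.eval, hx₁]) hxt)
    (B₂ := E.K * (E.n * 140 + 120) + 46) fun s₂ h₂ hF₂ => ?_)))
  · simp only [WordExpr.cost]; omega
  have hin₂ := ((hin₁.setReg (by omega)).setReg (by omega)).frame hF₂ (by decide)
  have hx₂ : s₂.reg 21 = x := by rw [hF₂.reg 21 (by decide)]; simp [hx₁]
  have hp₂ : s₂.reg 22 = p := by
    rw [hF₂.reg 22 (by decide)]; simp [hF₁.reg 22 (by decide), hp]
  have h40₂ : s₂.reg 40 = E.size p := by rw [hF₂.reg 40 (by decide)]; simp [WordExpr.eval, h₁]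
  have hnum : s₂.num 2 = s.num 2 := by
    rw [hF₂.num 2 (by decide)]; exact hF₁.num 2 (by decide)
  have hword : s₂.word 4 = s.word 4 := by
    rw [hF₂.word 4 (by decide)]; exact hF₁.word 4 (by decide)
  refine Runs.weaken ?_ (Runs.seq (runs_message hin₂ hx₂ hp₂ hxt hpt h₂ h40₂)
    (B₂ := E.K * (E.n * 70 + 60) + 24) fun s₃ h₃ hF₃ => ?_)
  · have : E.K * (E.n * 140) = 2 * (E.K * (E.n * 70)) := by ring
    simp only [mul_add]; omega
  have hin₃ := hin₂.frame hF₃ (by decide)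
  have hx₃ : s₃.reg 21 = x := by rw [hF₃.reg 21 (by decide), hx₂]
  refine Runs.seq (runs_absorb hin₃ hx₃
    (by rw [hF₃.reg 22 (by decide), hp₂]) hxt hpt (by rw [hF₃.reg 40 (by decide), h40₂]))
    (B₂ := 4) fun s₄ h₄' hF₄ => ?_
  refine Runs.weaken (by decide) (Runs.setWord ?_)
  have e0 : (WordExpr.const 0).eval E.w s₄ = 0 := eval_const (by omega)
  rw [eval_reg ((hF₄.reg 21 (by decide)).trans hx₃), e0]
  refine ⟨fun z => ?_, fun i y hy => ?_⟩
  · simp only [Store.setWord_word, true_and]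
    rw [hF₄.word 4 (by decide), hF₃.word 4 (by decide), hword]
  · rw [Store.setWord_num, h₄' i y hy, h₃ _ (restrict_lt _ _ _ _), hF₃.num 2 (by decide), hnum]

/-! ### Messages in terms of subsets, and the invariant of the elimination -/

theorem tbl_inter (E : BagData) (s : Store) (x : ℕ) (A : Finset ℕ) :
    E.tbl s x (A ∩ E.bag x) = E.tbl s x A := by
  rw [tbl, tbl, enc_inter]

theorem enc_injOn {B A A' : Finset ℕ} {n : ℕ} (hB : B ⊆ Finset.range n)
    (h : enc B A n = enc B A' n) : A ∩ B = A' ∩ B := by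
  have h1 := dec_enc B A n
  rw [h, dec_enc] at h1
  have key : ∀ A : Finset ℕ, (A ∩ B).filter (· < n) = A ∩ B := fun A =>
    Finset.filter_eq_self.2 fun v hv => Finset.mem_range.1 (hB (Finset.mem_inter.1 hv).2)
  rw [key, key] at h1
  exact h1.symm

theorem dec_enc_of_subset {B A : Finset ℕ} {n : ℕ} (hB : B ⊆ Finset.range n) (hA : A ⊆ B) :
    dec B (enc B A n) n = A := by
  rw [dec_enc, Finset.inter_eq_left.2 hA, Finset.filter_eq_self]
  exact fun v hv => Finset.mem_range.1 (hB (hA hv))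

/-- The message in terms of subsets of bags. -/
theorem message_eq (s : Store) {x p : ℕ} {A : Finset ℕ} (hA : A ⊆ E.bag p) :
    (∑ i' ∈ Finset.range (E.size x), (if E.restrict x x p i' =
      E.restrict p x p (enc (E.bag p) A E.n) then s.num 2 (i' * E.t + x) else 0)) =
    ∑ R ∈ (E.bag x).powerset with R ∩ E.bag p = A ∩ E.bag x, E.tbl s x R := by
  have hx := E.bag_subset x
  have hp := E.bag_subset p
  rw [Finset.sum_filter, size, ← sum_powerset_eq_sum_range hx (fun i' _ => if E.restrict x x p i' =
      E.restrict p x p (enc (E.bag p) A E.n) then s.num 2 (i' * E.t + x) else 0)]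
  refine Finset.sum_congr rfl fun R hR => ?_
  rw [Finset.mem_powerset] at hR
  rw [tbl]
  refine if_congr ?_ rfl rfl
  rw [restrict, restrict, dec_enc_of_subset hx hR, dec_enc_of_subset hp hA,
    Finset.inter_eq_left.2 hR]
  -- As `A` lies in the bag of `p`, intersecting once more loses nothing, and equality of the
  -- numbers becomes equality of the traces.
  have hAx : A ∩ E.bag x ∩ E.bag p = A ∩ E.bag x :=
    Finset.inter_eq_left.2 (Finset.inter_subset_left.trans hA)
  constructor
  · intro h
    rw [enc_injOn hp h, hAx]
  · intro h
    rw [← enc_inter, h, ← hAx, enc_inter]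

/-- The remaining nodes are `S`, and the tables have the value `Z`. -/
structure State (E : BagData) (Z : ℂ) (S : Finset ℕ) (s : Store) : Prop where
  subset : S ⊆ Finset.range E.t
  nonempty : S.Nonempty
  connectedOn : ConnectedOn E.adj S
  connectedOn_bag : ∀ v, ConnectedOn E.adj (S.filter fun x => v ∈ E.bag x)
  present : ∀ x < E.t, s.word 4 x = if x ∈ S then 1 else 0
  value : tableSum E.bag S (E.tbl s) = Z

theorem State.congr {Z : ℂ} {S : Finset ℕ} (h : E.State Z S s) (hw : s'.word 4 = s.word 4)
    (hn : s'.num 2 = s.num 2) : E.State Z S s' := by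
  refine ⟨h.subset, h.nonempty, h.connectedOn, h.connectedOn_bag, ?_, ?_⟩
  · rw [hw]; exact h.present
  · rw [← h.value]
    have : E.tbl s' = E.tbl s := by funext x A; rw [tbl, tbl, hn]
    rw [this]

theorem runs_elim_leaf (h : E.Input s) {Z : ℂ} {S : Finset ℕ} (hS : E.State Z S s) {x p : ℕ}
    (hleaf : IsLeafOn E.adj S x p) (hpx : p ≠ x) (hx : s.reg 21 = x) (hp : s.reg 22 = p) :
    Runs E.w elimProg s (E.K * (E.n * 140 + 120) + E.n * 38 + 80) (E.State Z (S.erase x)) := by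
  obtain ⟨hxS, hpS, hxp, huniq⟩ := hleaf
  have hxt := Finset.mem_range.1 (hS.subset hxS)
  have hpt := Finset.mem_range.1 (hS.subset hpS)
  refine Runs.mono (runs_elim h hx hp hxt hpt) le_rfl ?_
  rintro s' ⟨hword, hnum⟩ _
  refine ⟨(Finset.erase_subset _ _).trans hS.subset, ⟨p, Finset.mem_erase.2 ⟨hpx, hpS⟩⟩,
    hS.connectedOn.erase_leaf E.adj_symm huniq, fun v => ?_, fun y hy => ?_, ?_⟩
  · rw [Finset.filter_erase]
    exact (hS.connectedOn_bag v).erase_leaf E.adj_symm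
      fun y hy => huniq y (Finset.mem_filter.1 hy).1
  · rw [hword, hS.present y hy]
    by_cases hyx : y = x <;> simp [hyx]
  · rw [← hS.value]
    refine tableSum_erase hxS hpS hpx ?_ ?_ ?_
    -- The nodes containing `v` stay connected. If `x` and another node both contain `v`, then `x`
    -- has a neighbour containing `v`, and its only neighbour is `p`.
    · intro y hy hyx v hv
      rw [Finset.mem_inter] at hv
      obtain ⟨z, hz, hxz⟩ := (hS.connectedOn_bag v).exists_adj
        (Finset.mem_filter.2 ⟨hxS, hv.1⟩) (Finset.mem_filter.2 ⟨hy, hv.2⟩) (Ne.symm hyx)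
      rw [Finset.mem_filter] at hz
      rw [← huniq z hz.1 hxz]
      exact hz.2
    · intro y hy hyx hyp A _
      rw [tbl, tbl, hnum _ y (Finset.mem_range.1 (hS.subset hy)), if_neg (by tauto)]
    · intro A hA
      rw [tbl, hnum _ p hpt, if_pos ⟨rfl, enc_lt _ _ _⟩, message_eq s hA, tbl]

/-! ### Rounds -/

/-- `reg 50` becomes the number of the remaining neighbours of `reg 21`, and `reg 22` one of
them. -/
def degreeProg : Program :=
  .seq (.setReg 50 (.const 0)) (forLoop 51 2
    (.ite (.op .mul (.load 2 (.op .add (.op .mul (.reg 21) (.reg 2)) (.reg 51)))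
        (.load 4 (.reg 51)))
      (.seq (.setReg 50 (.op .add (.reg 50) (.const 1))) (.setReg 22 (.reg 51))) .skip))

open Classical in
theorem runs_degree (h : E.Input s) {Z : ℂ} {S : Finset ℕ} (hS : E.State Z S s) {x : ℕ}
    (hx : s.reg 21 = x) (hxt : x < E.t) :
    Runs E.w degreeProg s (E.t * 30 + 20) fun s' =>
      s'.reg 50 = ((Finset.range E.t).filter fun y => E.adj x y ∧ y ∈ S).card ∧
      (s'.reg 50 ≠ 0 → s'.reg 22 ∈ S ∧ E.adj x (s'.reg 22)) := by
  have h4 := E.four_lt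
  have ht := E.t_lt
  have e0 : (WordExpr.const 0).eval E.w s = 0 := eval_const (by omega)
  refine Runs.weaken ?_ (Runs.setReg_seq (Runs.forLoop (N := E.t) (c := 22) (fun k s' =>
      s'.reg 50 = ((Finset.range k).filter fun y => E.adj x y ∧ y ∈ S).card ∧
      (s'.reg 50 ≠ 0 → s'.reg 22 ∈ S ∧ E.adj x (s'.reg 22)))
    (by simp [h.reg2]) E.t_lt (by decide) (by decide) (by decide)
    (fun _ _ _ h => by simpa using h) (by simp [e0]) ?_))
  · simp only [WordExpr.cost]; omega
  rintro y s₁ hy hr ⟨hc, hI⟩ hF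
  have hin := (h.setReg (by omega)).frame hF (by decide)
  have hx₁ : s₁.reg 21 = x := by rw [hF.reg 21 (by decide)]; simp [hx]
  have hlt := mul_add_lt hxt hy
  have htt := E.t_mul_t_lt
  have ha : (WordExpr.load 2 (.op .add (.op .mul (.reg 21) (.reg 2)) (.reg 51))).eval E.w s₁ =
      if E.adj x y then 1 else 0 := by
    rw [← hin.adj x hxt y hy, WordExpr.eval, eval_add (eval_mul (eval_reg hx₁) (eval_reg hin.reg2)
      (by omega)) (eval_reg hr) (by omega)]
  have hp : (WordExpr.load 4 (.reg 51)).eval E.w s₁ = if y ∈ S then 1 else 0 := by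
    rw [WordExpr.eval, eval_reg hr, hF.word 4 (by decide)]
    exact hS.present y hy
  have hev := eval_and _ _ (by omega) ha hp
  have hcard : ((Finset.range y).filter fun y => E.adj x y ∧ y ∈ S).card ≤ y :=
    (Finset.card_filter_le _ _).trans (Finset.card_range y).le
  refine Runs.weaken (by decide) (Runs.ite (B := 8) ?_ ?_)
  · intro hne
    rw [hev] at hne
    have hc' : E.adj x y ∧ y ∈ S := by
      by_contra hc'; exact hne (if_neg hc')
    refine Runs.weaken (by decide) (Runs.setReg_seq (Runs.setReg ?_))
    rw [eval_add (eval_reg hc) (eval_const (by omega)) (by omega), Finset.range_add_one,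
      Finset.filter_insert, if_pos hc', Finset.card_insert_of_notMem (by simp)]
    simp [WordExpr.eval, hr, hc'.1, hc'.2]
  · intro h0
    rw [hev] at h0
    have hc' : ¬ (E.adj x y ∧ y ∈ S) := by
      intro hc'; simp [hc'] at h0
    refine Runs.weaken (by decide) (Runs.skip ?_)
    rw [Finset.range_add_one, Finset.filter_insert, if_neg hc']
    exact ⟨hc, hI⟩

/-- Eliminate the node `reg 21` if it is a leaf. -/
def stepProg : Program :=
  .seq degreeProg (.ite (.op .mul (.load 4 (.reg 21)) (.op .eq (.reg 50) (.const 1))) elimProg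
    .skip)

theorem runs_step (h : E.Input s) {Z : ℂ} {S : Finset ℕ} (hS : E.State Z S s) {x : ℕ}
    (hx : s.reg 21 = x) (hxt : x < E.t) (hirr : ¬ E.adj x x) :
    Runs E.w stepProg s (E.K * (E.n * 140 + 120) + E.n * 38 + E.t * 30 + 120) fun s' =>
      ((∀ p, ¬ IsLeafOn E.adj S x p) ∧ E.State Z S s') ∨
      (x ∈ S ∧ E.State Z (S.erase x) s') := by
  classical
  have h4 := E.four_lt
  refine Runs.weaken ?_ (Runs.seq (runs_degree h hS hx hxt)
    (B₂ := E.K * (E.n * 140 + 120) + E.n * 38 + 100) ?_)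
  · omega
  rintro s₁ ⟨hc, hI⟩ hF
  have hin := h.frame hF (by decide)
  have hS₁ : E.State Z S s₁ := hS.congr (hF.word 4 (by decide)) (hF.num 2 (by decide))
  have hx₁ : s₁.reg 21 = x := by rw [hF.reg 21 (by decide), hx]
  have hp : (WordExpr.load 4 (.reg 21)).eval E.w s₁ = if x ∈ S then 1 else 0 := by
    rw [WordExpr.eval, eval_reg hx₁, hS₁.present x hxt]
  have hev := eval_and _ _ (by omega) hp
    (eval_eq (by omega) (eval_reg hc) (eval_const (x := 1) (by omega)))
  refine Runs.weaken ?_ (Runs.ite (B := E.K * (E.n * 140 + 120) + E.n * 38 + 80) ?_ ?_)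
  · simp only [WordExpr.cost]; omega
  · intro hne
    rw [hev] at hne
    obtain ⟨hxS, h1⟩ : x ∈ S ∧
        ((Finset.range E.t).filter fun y => E.adj x y ∧ y ∈ S).card = 1 := by
      by_contra hc'; exact hne (if_neg hc')
    -- Register 22 holds the last neighbour seen, which is the only one when the count is 1.
    obtain ⟨h22, hadj⟩ := hI (by omega)
    obtain ⟨z, hz⟩ := Finset.card_eq_one.1 h1
    have hmem : ∀ y ∈ S, E.adj x y → y = z := fun y hy hxy => by
      have : y ∈ (Finset.range E.t).filter fun y => E.adj x y ∧ y ∈ S :=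
        Finset.mem_filter.2 ⟨hS.subset hy, hxy, hy⟩
      rw [hz] at this
      simpa using this
    refine Runs.mono (runs_elim_leaf hin hS₁ (x := x) (p := s₁.reg 22)
      ⟨hxS, h22, hadj, fun y hy hxy => by rw [hmem y hy hxy, hmem _ h22 hadj]⟩
      (fun hh => hirr (by rwa [hh] at hadj)) hx₁ rfl) le_rfl fun s' hs' _ => Or.inr ⟨hxS, hs'⟩
  · intro h0
    rw [hev] at h0
    refine Runs.weaken (by omega) (Runs.skip (Or.inl ⟨?_, hS₁⟩))
    rintro p ⟨hxS, hpS, hxp, huniq⟩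
    have h1 : ((Finset.range E.t).filter fun y => E.adj x y ∧ y ∈ S) = {p} := by
      ext y
      simp only [Finset.mem_filter, Finset.mem_singleton]
      constructor
      · exact fun hy => huniq y hy.2.2 hy.2.1
      · rintro rfl; exact ⟨hS.subset hpS, hxp, hpS⟩
    rw [h1] at h0
    simp [hxS] at h0

/-- Try all nodes once. -/
def roundProg : Program := forLoop 21 2 stepProg

/-- If a pass removed nothing, every node would have been tested against the same set `S` and found
not to be a leaf, contradicting `E.exists_leaf`. Hence no queue of leaves or traversal order is
needed. -/
theorem runs_round (h : E.Input s) {Z : ℂ} {S : Finset ℕ} (hS : E.State Z S s)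
    (hirr : ∀ x, ¬ E.adj x x) :
    Runs E.w roundProg s (E.t * (E.K * (E.n * 140 + 120) + E.n * 38 + E.t * 30 + 128) + 6)
      fun s' => ∃ S' ⊆ S, E.State Z S' s' ∧ (2 ≤ S.card → S'.card < S.card) := by
  refine Runs.mono (Runs.forLoop (c := E.K * (E.n * 140 + 120) + E.n * 38 + E.t * 30 + 120)
    (N := E.t) (fun k s' => ∃ S' ⊆ S, E.State Z S' s' ∧
      (S' = S → ∀ x < k, ∀ p, ¬ IsLeafOn E.adj S x p)) h.reg2 E.t_lt (by decide) (by decide)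
    (by decide) ?_ ⟨S, subset_rfl, hS, by simp⟩ ?_) le_rfl ?_
  · rintro i s x ⟨S', hS', hst, hl⟩
    exact ⟨S', hS', hst.congr rfl rfl, hl⟩
  · rintro x s₁ hx hr ⟨S', hS', hst, hl⟩ hF
    refine Runs.mono (runs_step (h.frame hF (by decide)) hst hr hx (hirr x)) le_rfl ?_
    rintro s₂ (⟨hno, h₂⟩ | ⟨hxS, h₂⟩) _
    · refine ⟨S', hS', h₂, ?_⟩
      rintro rfl y hy
      rcases Nat.lt_succ_iff_lt_or_eq.1 hy with hy | rfl
      · exact hl rfl y hy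
      · exact hno
    · refine ⟨S'.erase x, (Finset.erase_subset _ _).trans hS', h₂, fun heq => ?_⟩
      have := hS' hxS
      rw [← heq] at this
      exact absurd rfl (Finset.mem_erase.1 this).1
  · rintro s₁ ⟨S', hS', hst, hl⟩ _
    refine ⟨S', hS', hst, fun h2 => ?_⟩
    refine Finset.card_lt_card (lt_of_le_of_ne hS' fun heq => ?_)
    obtain ⟨x, p, hleaf⟩ := E.exists_leaf S hS.subset hS.connectedOn h2
    exact hl heq x (Finset.mem_range.1 (hS.subset hleaf.1)) p hleaf

/-- Eliminate all nodes but one. -/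
def roundsProg : Program := forLoop 52 2 roundProg

theorem runs_rounds (h : E.Input s) {Z : ℂ} (hS : E.State Z (Finset.range E.t) s)
    (hirr : ∀ x, ¬ E.adj x x) :
    Runs E.w roundsProg s
      (E.t * (E.t * (E.K * (E.n * 140 + 120) + E.n * 38 + E.t * 30 + 128) + 14) + 6)
      fun s' => ∃ x < E.t, E.State Z {x} s' := by
  refine Runs.mono (Runs.forLoop
    (c := E.t * (E.K * (E.n * 140 + 120) + E.n * 38 + E.t * 30 + 128) + 6)
    -- At `k = E.t` the first alternative fails because `S` is nonempty, so a single node remains.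
    (N := E.t) (fun k s' => ∃ S, E.State Z S s' ∧ (S.card + k ≤ E.t ∨ S.card = 1)) h.reg2 E.t_lt
    (by decide) (by decide) (by decide) ?_ ⟨_, hS, by simp⟩ ?_) le_rfl ?_
  · rintro i s x ⟨S', hst, hl⟩
    exact ⟨S', hst.congr rfl rfl, hl⟩
  · rintro k s₁ hk hr ⟨S, hst, hl⟩ hF
    refine Runs.mono (runs_round (h.frame hF (by decide)) hst hirr) le_rfl ?_
    rintro s₂ ⟨S', hS', hst', hlt⟩ _
    refine ⟨S', hst', ?_⟩
    have h1 := Finset.card_le_card hS'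
    have h2 := hst'.nonempty.card_pos
    by_cases h3 : 2 ≤ S.card
    · have := hlt h3; omega
    · omega
  · rintro s₁ ⟨S, hst, hl⟩ _
    have h2 := hst.nonempty.card_pos
    obtain ⟨x, rfl⟩ := Finset.card_eq_one.1 (show S.card = 1 by omega)
    exact ⟨x, by simpa using hst.subset, hst⟩

/-- Add up the table of the remaining node in cell `2` of number array `4`. -/
def sumProg : Program :=
  .seq (.setNum 4 (.const 2) (.ofWord (.const 0))) (forLoop 53 2 (.ite (.load 4 (.reg 53))
    (.seq (.setReg 10 (.reg 53)) (.seq sizeProg (forLoop 54 12 (.setNum 4 (.const 2)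
      (.op .add (.load 4 (.const 2)) (tableExpr 54 53)))))) .skip))

/-- The presence marks identify the surviving node. The other cells of array `4` are tracked by hand
because a frame speaks only of whole arrays; cell `3` must keep `2^k` during the second run. -/
theorem runs_sum (h : E.Input s) {Z : ℂ} {r : ℕ} (hrt : r < E.t) (hS : E.State Z {r} s) :
    Runs E.w sumProg s (E.t * (E.K * 24 + E.n * 19 + 40) + 20) fun s' => s'.num 4 2 = Z ∧
      s'.num 4 1 = s.num 4 1 ∧ s'.num 4 0 = s.num 4 0 ∧ s'.num 4 3 = s.num 4 3 := by
  have h4 := E.four_lt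
  have e0 : (WordExpr.const 0).eval E.w s = 0 := eval_const (by omega)
  have e2 : ∀ s, (WordExpr.const 2).eval E.w s = 2 := fun _ => eval_const (by omega)
  have hZ : ∑ i ∈ Finset.range (E.size r), s.num 2 (i * E.t + r) = Z := by
    rw [← hS.value, tableSum, Finset.singleton_biUnion, size,
      ← sum_powerset_eq_sum_range (E.bag_subset r) (fun i _ => s.num 2 (i * E.t + r))]
    refine Finset.sum_congr rfl fun A _ => ?_
    rw [Finset.prod_singleton, tbl_inter, tbl]
  refine Runs.mono (Runs.setNum_seq (Runs.forLoop (N := E.t) (c := E.K * 24 + E.n * 19 + 32)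
    (fun k s' => s'.num 4 2 = (if r < k then Z else 0) ∧
      s'.num 4 1 = s.num 4 1 ∧ s'.num 4 0 = s.num 4 0 ∧ s'.num 4 3 = s.num 4 3)
    h.reg2 E.t_lt (by decide) (by decide) (by decide) (fun _ _ _ h => h)
    (by simp [e2, NumExpr.eval, e0]) ?_)) ?_ ?_
  rotate_left
  · rw [show E.K * 24 + E.n * 19 + 32 + 8 = E.K * 24 + E.n * 19 + 40 by omega]
    simp only [WordExpr.cost, NumExpr.cost]; omega
  · rintro s₁ ⟨h₁, h₂⟩ _
    exact ⟨by rw [h₁, if_pos hrt], h₂⟩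
  rintro x s₁ hx hr ⟨hI, hI1, hI0, hI3⟩ hF
  have hin := (h.setNum _ _ _).frame hF (by decide)
  have hw : (WordExpr.load 4 (.reg 53)).eval E.w s₁ = if x = r then 1 else 0 := by
    rw [WordExpr.eval, eval_reg hr, hF.word 4 (by decide), Store.setNum_word, hS.present x hx]
    simp
  have hn2 : s₁.num 2 = s.num 2 := by
    rw [hF.num 2 (by decide)]; funext i; simp
  refine Runs.weaken ?_ (Runs.ite (B := E.K * 24 + E.n * 19 + 20) ?_ ?_)
  · simp only [WordExpr.cost]; omega
  · intro hne
    rw [hw] at hne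
    obtain rfl : x = r := by by_contra hc'; exact hne (if_neg hc')
    have hsz := Nat.mul_le_mul_right 24 (E.size_le x)
    refine Runs.mono (Runs.setReg_seq (Runs.seq (runs_size (x := x) (hin.setReg (by omega))
      (by simp [WordExpr.eval, hr]) hx) fun s₂ h12 hF₂ => Runs.forLoop (c := 16)
        (N := E.size x) (fun k s' => s'.num 4 2 = ∑ i ∈ Finset.range k, s.num 2 (i * E.t + x) ∧
          s'.num 4 1 = s.num 4 1 ∧ s'.num 4 0 = s.num 4 0 ∧ s'.num 4 3 = s.num 4 3) h12
        (E.size_lt x) (by decide) (by decide) (by decide) (fun _ _ _ h => h) ?_ ?_)) ?_ ?_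
    · rw [hF₂.num 4 (by decide)]
      simp [hI, hI1, hI0, hI3]
    · rintro i s₃ hi hr₃ ⟨hJ, hJ'⟩ hF₃
      have hin₃ := ((hin.setReg (by omega)).frame hF₂ (by decide)).frame hF₃ (by decide)
      have h53 : s₃.reg 53 = x := by
        rw [hF₃.reg 53 (by decide), hF₂.reg 53 (by decide)]; simp [hr]
      refine Runs.weaken (by decide) (Runs.setNum ?_)
      simp only [Store.setNum_num, e2, NumExpr.eval, NumOp.eval]
      rw [hin₃.eval_table hr₃ h53 (lt_of_lt_of_le hi (E.size_le x)) hx, hJ,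
        hF₃.num 2 (by decide), hF₂.num 2 (by decide), Store.setReg_num, hn2,
        Finset.sum_range_succ]
      simpa using hJ'
    · simp only [WordExpr.cost]; omega
    · rintro s₃ ⟨h₃, h₃'⟩ _
      exact ⟨by rw [h₃, hZ]; simp, h₃'⟩
  · intro h0
    rw [hw] at h0
    have hxr : x ≠ r := by rintro rfl; simp at h0
    refine Runs.weaken (by omega) (Runs.skip ⟨?_, hI1, hI0, hI3⟩)
    rw [hI]
    refine if_congr ?_ rfl rfl
    omega

/-- The partition function for the weights in cells `1` and `0` of number array `4`. -/
def isingProg : Program := .seq initProg (.seq edgesProg (.seq roundsProg sumProg))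

/-- The number of steps of `isingProg`. -/
def isingTime (E : BagData) : ℕ :=
  (E.t * (E.K * 19 + E.n * 19 + 30) + 6) +
    ((E.m * (E.t * 26 + E.n * 57 + E.K * 40 + 68) + 6) +
      ((E.t * (E.t * (E.K * (E.n * 140 + 120) + E.n * 38 + E.t * 30 + 128) + 14) + 6) +
        (E.t * (E.K * 24 + E.n * 19 + 40) + 20)))

theorem runs_ising (h : E.Input s) {p q : ℂ} (hp : s.num 4 1 = p) (hq : s.num 4 0 = q)
    (hirr : ∀ x, ¬ E.adj x x) :
    Runs E.w isingProg s E.isingTime fun s' =>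
      s'.num 4 2 = ∑ A ∈ (Finset.range E.n).powerset, ∏ e ∈ Finset.range E.m, E.weight p q e A ∧
      s'.num 4 3 = s.num 4 3 := by
  refine Runs.seq (runs_init h) fun s₁ h₁ hF₁ => ?_
  have hin₁ := h.frame hF₁ (by decide)
  have hn₁ : s₁.num 4 = s.num 4 := hF₁.num 4 (by decide)
  refine Runs.seq (runs_edges hin₁ (by rw [hn₁, hp]) (by rw [hn₁, hq])
    fun x hx A => (h₁ x hx).2 _ (enc_lt _ _ _)) fun s₂ h₂ hF₂ => ?_
  have hin₂ := hin₁.frame hF₂ (by decide)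
  have hn₂ : s₂.num 4 = s.num 4 := (hF₂.num 4 (by decide)).trans hn₁
  refine Runs.seq (runs_rounds hin₂ (Z := ∑ A ∈ (Finset.range E.n).powerset,
    ∏ e ∈ Finset.range E.m, E.weight p q e A) ⟨subset_rfl, ?_, E.connectedOn, E.connectedOn_bag,
      fun x hx => ?_, ?_⟩ hirr) ?_
  · exact ⟨0, Finset.mem_range.2 E.t_pos⟩
  · rw [hF₂.word 4 (by decide), (h₁ x hx).1, if_pos (Finset.mem_range.2 hx)]
  · rw [tableSum, E.biUnion_bag]
    refine Finset.sum_congr rfl fun A _ => ?_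
    simp_rw [tbl_inter]
    exact h₂ A
  rintro s₃ ⟨r, hr, h₃⟩ hF₃
  refine Runs.mono (runs_sum (hin₂.frame hF₃ (by decide)) hr h₃) le_rfl ?_
  rintro s₄ ⟨h, _, _, h3⟩ _
  exact ⟨h, by rw [h3, hF₃.num 4 (by decide), hn₂]⟩

/-! ### The Tutte polynomial -/

/-- Divide the output by `(b - 1) ^ n * (a - 1) ^ k`, where cell `3` of number array `4` holds
`2 ^ k`. -/
def divideProg : Program :=
  forLoop 55 0 (.seq (.setNum 1 (.const 0) (.op .div (.load 1 (.const 0))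
      (.op .sub (.load 0 (.const 1)) (.ofWord (.const 1)))))
    (.seq (.testZero 56 (.op .sub (.load 4 (.const 3)) (.ofWord (.const 1))))
      (.ite (.reg 56) .skip
        (.seq (.setNum 4 (.const 3) (.op .div (.load 4 (.const 3)) (.ofWord (.const 2))))
          (.setNum 1 (.const 0) (.op .div (.load 1 (.const 0))
            (.op .sub (.load 0 (.const 0)) (.ofWord (.const 1)))))))))

/-- Each of the `n` rounds divides by `b - 1`. As long as the stored power of two is not `1`, a
round also halves it and divides by `a - 1`; `k ≤ n` ensures that all `k` divisions take place. -/
theorem runs_divide (h : E.Input s) {a b Z : ℂ} {k : ℕ} (ha : s.num 0 0 = a) (hb : s.num 0 1 = b)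
    (ha1 : a - 1 ≠ 0) (hb1 : b - 1 ≠ 0) (hk : s.num 4 3 = 2 ^ k) (hkn : k ≤ E.n)
    (hZ : s.num 1 0 = Z) :
    Runs E.w divideProg s (E.n * 100 + 6) fun s' =>
      s'.num 1 0 * ((a - 1) ^ k * (b - 1) ^ E.n) = Z := by
  have h4 := E.four_lt
  have e0 : ∀ s, (WordExpr.const 0).eval E.w s = 0 := fun _ => eval_const (by omega)
  have e1 : ∀ s, (WordExpr.const 1).eval E.w s = 1 := fun _ => eval_const (by omega)
  have e2 : ∀ s, (WordExpr.const 2).eval E.w s = 2 := fun _ => eval_const (by omega)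
  have e3 : ∀ s, (WordExpr.const 3).eval E.w s = 3 := fun _ => eval_const (by omega)
  refine Runs.mono (Runs.forLoop (N := E.n) (c := 92) (fun i s' => s'.num 4 3 = 2 ^ (k - i) ∧
    s'.num 1 0 * ((a - 1) ^ min i k * (b - 1) ^ i) = Z) h.reg0 E.n_lt (by decide) (by decide)
    (by decide) (fun _ _ _ h => h) (by simp [hk, hZ]) ?_) le_rfl ?_
  rotate_left
  · rintro s₁ ⟨_, h₁⟩ _
    rwa [min_eq_right hkn] at h₁
  rintro i s₁ hi hr ⟨hc, hI⟩ hF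
  have ha' : s₁.num 0 0 = a := by rw [hF.num 0 (by decide), ha]
  have hb' : s₁.num 0 1 = b := by rw [hF.num 0 (by decide), hb]
  refine Runs.weaken ?_ (Runs.setNum_seq (Runs.seq (Runs.testZero (by omega) (Q := fun s' =>
    (s'.reg 56 ≠ 0 ↔ k ≤ i) ∧ s'.num 0 0 = a ∧ s'.num 4 3 = 2 ^ (k - i) ∧
      s'.num 1 0 * ((a - 1) ^ min i k * (b - 1) ^ (i + 1)) = Z) ?_)
    (B₂ := 50) ?_))
  · decide
  · simp only [NumExpr.eval, NumOp.eval, e0, e1, e3, Store.setReg_num, Store.setNum_num,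
      Store.setReg_reg]
    refine ⟨?_, by simp [ha'], by simp [hc], ?_⟩
    -- The truncated exponent vanishes exactly from round `k` on.
    · have : ((2 : ℂ) ^ (k - i) - 1 = 0) ↔ k ≤ i := by
        rw [sub_eq_zero]
        constructor
        · intro hh
          have hh' : 2 ^ (k - i) = 1 := by exact_mod_cast hh
          rcases Nat.pow_eq_one.1 hh' with hh' | hh' <;> omega
        · intro hh; simp [Nat.sub_eq_zero_of_le hh]
      simp [hc, this]
    · simp only [and_self, if_true, hb', Nat.cast_one]
      rw [← hI, pow_succ]
      field_simp
  · rintro s₂ ⟨ht, ha₂, hc₂, hI₂⟩ _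
    refine Runs.weaken ?_ (Runs.ite (B := 40) (fun hne => ?_) fun h0 => ?_)
    · decide
    · have hki := ht.1 hne
      refine Runs.weaken (by decide) (Runs.skip ⟨?_, ?_⟩)
      · rw [hc₂]; congr 1; omega
      · rwa [min_eq_right (by omega), ← min_eq_right hki]
    · have hki : ¬ k ≤ i := fun hh => ht.2 hh h0
      refine Runs.weaken ?_ (Runs.setNum_seq (Runs.setNum ⟨?_, ?_⟩))
      · decide
      · simp only [NumExpr.eval, NumOp.eval, e0, e2, e3, Store.setNum_num]
        rw [hc₂, show k - i = k - (i + 1) + 1 by omega, pow_succ]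
        simp
      · simp only [NumExpr.eval, NumOp.eval, e0, e1, e3, Store.setNum_num]
        rw [min_eq_left (by omega)] at hI₂ ⊢
        simp only [and_self, if_true, ha₂, Nat.cast_one]
        rw [← hI₂, pow_succ (a - 1)]
        simp
        field_simp

/-- Evaluate the Tutte polynomial at a point of `H₂`. -/
def tutteProg : Program :=
  .seq (.setNum 4 (.const 1) (.ofWord (.const 1))) (.seq (.setNum 4 (.const 0) (.ofWord (.const 0)))
    (.seq isingProg
      (.seq (.setNum 4 (.const 3) (.load 4 (.const 2))) (.seq (.setNum 4 (.const 1)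
        (.load 0 (.const 1))) (.seq (.setNum 4 (.const 0) (.ofWord (.const 1)))
          (.seq isingProg (.seq (.setNum 1 (.const 0) (.load 4 (.const 2))) divideProg)))))))

/-- Two runs of the same routine, with weights `1, 0` for `2^k` and `b, 1` for `Z`; the second run
starts by resetting the tables and marks. -/
theorem runs_tutte (h : E.Input s) {a b Z : ℂ} {k : ℕ} (ha : s.num 0 0 = a) (hb : s.num 0 1 = b)
    (ha1 : a - 1 ≠ 0) (hb1 : b - 1 ≠ 0) (hkn : k ≤ E.n) (hirr : ∀ x, ¬ E.adj x x)
    (hk : ∑ A ∈ (Finset.range E.n).powerset, ∏ e ∈ Finset.range E.m, E.weight 1 0 e A = 2 ^ k)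
    (hZ : ∑ A ∈ (Finset.range E.n).powerset, ∏ e ∈ Finset.range E.m, E.weight b 1 e A = Z) :
    Runs E.w tutteProg s (2 * E.isingTime + E.n * 100 + 50) fun s' =>
      s'.num 1 0 * ((a - 1) ^ k * (b - 1) ^ E.n) = Z := by
  have h4 := E.four_lt
  have e0 : ∀ s, (WordExpr.const 0).eval E.w s = 0 := fun _ => eval_const (by omega)
  have e1 : ∀ s, (WordExpr.const 1).eval E.w s = 1 := fun _ => eval_const (by omega)
  have e2 : ∀ s, (WordExpr.const 2).eval E.w s = 2 := fun _ => eval_const (by omega)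
  have e3 : ∀ s, (WordExpr.const 3).eval E.w s = 3 := fun _ => eval_const (by omega)
  refine Runs.weaken ?_ (Runs.setNum_seq (Runs.setNum_seq (Runs.seq
    (runs_ising (p := 1) (q := 0) ((h.setNum _ _ _).setNum _ _ _) ?_ ?_ hirr)
    (B₂ := E.isingTime + E.n * 100 + 40) ?_)))
  · simp only [WordExpr.cost, NumExpr.cost]; omega
  · simp [e0, e1, NumExpr.eval]
  · simp [e0, NumExpr.eval]
  rintro s₁ ⟨h₁, _⟩ hF₁
  have hin₁ := ((h.setNum _ _ _).setNum _ _ _).frame hF₁ (by decide)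
  have ha₁ : s₁.num 0 0 = a := by rw [hF₁.num 0 (by decide)]; simpa using ha
  have hb₁ : s₁.num 0 1 = b := by rw [hF₁.num 0 (by decide)]; simpa using hb
  refine Runs.weaken ?_ (Runs.setNum_seq (Runs.setNum_seq (Runs.setNum_seq (Runs.seq
    (runs_ising (p := b) (q := 1) (((hin₁.setNum _ _ _).setNum _ _ _).setNum _ _ _) ?_ ?_ hirr)
    (B₂ := E.n * 100 + 12) ?_))))
  · simp only [WordExpr.cost, NumExpr.cost]; omega
  · simp [e0, e1, e3, NumExpr.eval, hb₁]
  · simp [e0, e1, NumExpr.eval]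
  rintro s₂ ⟨h₂, h₂'⟩ hF₂
  have hin₂ := (((hin₁.setNum _ _ _).setNum _ _ _).setNum _ _ _).frame hF₂ (by decide)
  refine Runs.weaken ?_ (Runs.setNum_seq (runs_divide (k := k) (Z := Z) (hin₂.setNum _ _ _)
    ?_ ?_ ha1 hb1 ?_ hkn ?_))
  · simp only [WordExpr.cost, NumExpr.cost]; omega
  · simp [e0, hF₂.num 0 (by decide), ha₁]
  · simp [e0, hF₂.num 0 (by decide), hb₁]
  · simp [e0, h₂', e1, e2, e3, NumExpr.eval, h₁, hk]
  · simp [e0, e2, NumExpr.eval, h₂, hZ]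

end BagData

/-! ### Tree decompositions as bag data -/

section Interface

variable {n m t : ℕ} {G : Multigraph n m}

/-- The bags on the natural numbers. -/
def TreeDecomposition.natBag (D : TreeDecomposition G t) (x : ℕ) : Finset ℕ :=
  if h : x < t then (D.bag ⟨x, h⟩).map Fin.valEmbedding else ∅

theorem TreeDecomposition.mem_natBag (D : TreeDecomposition G t) {x v : ℕ} :
    v ∈ D.natBag x ↔ ∃ (hx : x < t) (hv : v < n), (⟨v, hv⟩ : Fin n) ∈ D.bag ⟨x, hx⟩ := by
  unfold natBag
  split_ifs with h
  · simp only [Finset.mem_map, Fin.valEmbedding_apply, h, exists_true_left]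
    constructor
    · rintro ⟨u, hu, rfl⟩; exact ⟨u.2, hu⟩
    · rintro ⟨hv, hu⟩; exact ⟨_, hu, rfl⟩
  · simp [h]

theorem TreeDecomposition.natBag_subset (D : TreeDecomposition G t) (x : ℕ) :
    D.natBag x ⊆ Finset.range n := fun v hv => by
  obtain ⟨_, hv, _⟩ := D.mem_natBag.1 hv
  exact Finset.mem_range.2 hv

/-- A bag has at most `width + 1` elements even when all bags are empty and the subtraction in the
width truncates. -/
theorem TreeDecomposition.pow_count_le (D : TreeDecomposition G t) (x : ℕ) :
    2 ^ Nat.count (· ∈ D.natBag x) n ≤ 2 ^ (D.width + 1) := by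
  refine Nat.pow_le_pow_right (by norm_num) ?_
  rw [count_eq_card (D.natBag_subset x), natBag]
  split_ifs with h
  · rw [Finset.card_map]
    have := Finset.le_sup (f := fun x => (D.bag x).card) (Finset.mem_univ (⟨x, h⟩ : Fin t))
    simp only [width] at *
    omega
  · simp

/-- The end points of the edges as natural numbers. -/
def Multigraph.natEnds (G : Multigraph n m) (e : ℕ) : ℕ × ℕ :=
  if h : e < m then ((G.ends ⟨e, h⟩).1, (G.ends ⟨e, h⟩).2) else (0, 0)

/-- A tree decomposition together with a sufficient word length. -/
def TreeDecomposition.toBagData (D : TreeDecomposition G t) (w : ℕ) (ht : 0 < t) (h4 : 4 < 2 ^ w)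
    (hn : n < 2 ^ w) (hm : m < 2 ^ w) (hK : 2 ^ (D.width + 1) * t < 2 ^ w) (htn : t * n < 2 ^ w)
    (htt : t * t < 2 ^ w) : BagData where
  w := w
  n := n
  m := m
  t := t
  K := 2 ^ (D.width + 1)
  bag := D.natBag
  adj := natAdj D.tree
  u e := (G.natEnds e).1
  v e := (G.natEnds e).2
  bag_subset := D.natBag_subset
  pow_le := D.pow_count_le
  u_lt e he := by simp [Multigraph.natEnds, he]
  v_lt e he := by simp [Multigraph.natEnds, he]
  edge_mem e he := by
    obtain ⟨x, hu, hv⟩ := D.edge_mem ⟨e, he⟩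
    refine ⟨x, x.2, ?_, ?_⟩ <;> rw [D.mem_natBag] <;> simp only [Multigraph.natEnds, he, dite_true]
    · exact ⟨x.2, Fin.is_lt _, hu⟩
    · exact ⟨x.2, Fin.is_lt _, hv⟩
  biUnion_bag := by
    ext v
    rw [Finset.mem_biUnion, Finset.mem_range]
    constructor
    · rintro ⟨x, _, hv⟩
      exact Finset.mem_range.1 (D.natBag_subset x hv)
    · intro hv
      obtain ⟨x, hx⟩ := D.vertex_mem ⟨v, hv⟩
      exact ⟨x, Finset.mem_range.2 x.2, D.mem_natBag.2 ⟨x.2, hv, hx⟩⟩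
  adj_symm := natAdj_symm D.tree
  connectedOn := by
    refine connectedOn_of_induce (fun x hx => Finset.mem_range.1 hx) ?_
    have : {x : Fin t | (x : ℕ) ∈ Finset.range t} = Set.univ := by ext x; simp
    rw [this]
    exact ((SimpleGraph.induceUnivIso D.tree).connected_iff.2 D.isTree.connected).preconnected
  connectedOn_bag v := by
    by_cases hv : v < n
    · refine connectedOn_of_induce
        (fun x hx => Finset.mem_range.1 (Finset.mem_filter.1 hx).1) ?_
      have : {x : Fin t | (x : ℕ) ∈ (Finset.range t).filter fun x => v ∈ D.natBag x} =
          {x | (⟨v, hv⟩ : Fin n) ∈ D.bag x} := by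
        ext x; simp [D.mem_natBag, hv]
      rw [this]
      exact (D.subtree ⟨v, hv⟩).preconnected
    -- A number `v ≥ n` lies in no bag, so there is nothing to connect.
    · intro x hx
      exact absurd (Finset.mem_range.1 (D.natBag_subset x (Finset.mem_filter.1 hx).2)) hv
  exists_leaf S hS hc h2 :=
    ConnectedOn.exists_leaf D.isTree.isAcyclic (fun x hx => Finset.mem_range.1 (hS hx)) hc h2
  t_pos := ht
  four_lt := h4
  n_lt := hn
  m_lt := hm
  K_mul_lt := hK
  t_mul_n_lt := htn
  t_mul_t_lt := htt

variable {D : TreeDecomposition G t} {w : ℕ} {ht : 0 < t} {h4 : 4 < 2 ^ w}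
    {hn : n < 2 ^ w} {hm : m < 2 ^ w} {hK : 2 ^ (D.width + 1) * t < 2 ^ w} {htn : t * n < 2 ^ w}
    {htt : t * t < 2 ^ w}

open Classical in
theorem TreeDecomposition.input_toBagData (a b : ℂ) :
    (D.toBagData w ht h4 hn hm hK htn htt).Input (input G D a b) := by
  constructor
  · simp [input, toBagData]
  · simp [input, toBagData]
  · simp [input, toBagData]
  · intro e he
    simp only [toBagData] at he ⊢
    simp [input, Multigraph.natEnds, he]
  · intro e he
    simp only [toBagData] at he ⊢
    simp [input, Multigraph.natEnds, he]
  · intro x hx y hy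
    simp only [toBagData] at hx hy ⊢
    simp only [input]
    rw [if_neg (by decide), if_neg (by decide), if_pos True.intro]
    refine if_congr ?_ rfl rfl
    constructor
    · rintro ⟨x', y', hxy, hadj⟩
      rw [BagData.mul_add_inj hy y'.2] at hxy
      obtain ⟨rfl, rfl⟩ := hxy
      exact ⟨hx, hy, hadj⟩
    · rintro ⟨_, _, hadj⟩
      exact ⟨⟨x, hx⟩, ⟨y, hy⟩, rfl, hadj⟩
  · intro x hx v hv
    simp only [toBagData] at hx hv ⊢
    simp only [input]
    rw [if_neg (by decide), if_neg (by decide), if_neg (by decide), if_pos True.intro]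
    refine if_congr ?_ rfl rfl
    rw [D.mem_natBag]
    constructor
    · rintro ⟨x', v', hxv, hmem⟩
      rw [BagData.mul_add_inj hv v'.2] at hxv
      obtain ⟨rfl, rfl⟩ := hxv
      exact ⟨hx, hv, hmem⟩
    · rintro ⟨_, _, hmem⟩
      exact ⟨⟨x, hx⟩, ⟨v, hv⟩, rfl, hmem⟩

theorem TreeDecomposition.sum_weight (p q : ℂ) :
    ∑ A ∈ (Finset.range n).powerset, ∏ e ∈ Finset.range m,
      (D.toBagData w ht h4 hn hm hK htn htt).weight p q e A = G.ising p q := by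
  classical
  rw [Multigraph.ising]
  refine Finset.sum_bij' (fun A _ v => decide ((v : ℕ) ∈ A))
    (fun σ _ => (Finset.univ.filter fun v => σ v = true).map Fin.valEmbedding) ?_ ?_ ?_ ?_ ?_
  · simp
  · intro σ _
    rw [Finset.mem_powerset]
    intro v hv
    simp only [Finset.mem_map, Fin.valEmbedding_apply] at hv
    obtain ⟨u, _, rfl⟩ := hv
    exact Finset.mem_range.2 u.2
  · intro A hA
    rw [Finset.mem_powerset] at hA
    ext v
    simp only [Finset.mem_map, Finset.mem_filter, Finset.mem_univ, true_and, decide_eq_true_eq,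
      Fin.valEmbedding_apply]
    constructor
    · rintro ⟨u, hu, rfl⟩; exact hu
    · exact fun hv => ⟨⟨v, Finset.mem_range.1 (hA hv)⟩, hv, rfl⟩
  · intro σ _
    funext v
    simp [Fin.val_inj]
  · intro A _
    rw [Finset.prod_range]
    refine Finset.prod_congr rfl fun e _ => ?_
    simp [BagData.weight, toBagData, Multigraph.natEnds]

end Interface
end TutteRAM

/-! ### Assembly and choice of the constants -/

theorem mainTheorem7 :
    ∃ (P : TutteRAM.Program) (C d : ℕ),
      ∀ (n m t : ℕ) (G : TutteRAM.Multigraph n m) (D : TutteRAM.TreeDecomposition G t) (a b : ℂ),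
        (a, b) ∈ TutteRAM.hyperbola 2 →
        ∀ w : ℕ, C * 2 ^ D.width * (n + m + t) ^ d ≤ 2 ^ w →
          ∃ (T : ℕ) (s : TutteRAM.Store),
            TutteRAM.Exec w P (TutteRAM.input G D a b) T s ∧
            T ≤ C * 2 ^ D.width * (n + m + t) ^ d ∧
            s.output = G.tutte a b := by
  -- The leading cost is `t` rounds of `t` nodes with work `2^tw * n` each, hence `d = 3`. The two
  -- runs of at most `2000 * X * N ^ 3` steps and the division fit generously into `10000`.
  refine ⟨TutteRAM.BagData.tutteProg, 10000, 3, fun n m t G D a b hab w hw => ?_⟩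
  have hab' : (a - 1) * (b - 1) = 2 := hab
  have ha1 : a - 1 ≠ 0 := by rintro h; simp [h] at hab'
  have hb1 : b - 1 ≠ 0 := by rintro h; simp [h] at hab'
  -- A tree has a node, so `N ≥ 1` even for the empty graph, and lower powers of `N` are bounded by
  -- higher ones.
  have ht : 0 < t := by
    obtain ⟨x⟩ := D.isTree.connected.nonempty
    exact x.pos
  set N := n + m + t with hN
  set X := 2 ^ D.width with hX
  have hX1 : 1 ≤ X := Nat.one_le_two_pow
  have hN1 : 1 ≤ N := by omega
  have hnN : n ≤ N := by omega
  have hmN : m ≤ N := by omega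
  have htN : t ≤ N := by omega
  have hN2 : N ≤ N ^ 2 := by nlinarith
  have hN3 : N ^ 2 ≤ N ^ 3 := Nat.pow_le_pow_right hN1 (by norm_num)
  have hNX : N ^ 3 ≤ X * N ^ 3 := Nat.le_mul_of_pos_left _ hX1
  have hXN : X * N ≤ X * N ^ 3 := Nat.mul_le_mul_left _ (hN2.trans hN3)
  have hXN2 : X * N ^ 2 ≤ X * N ^ 3 := Nat.mul_le_mul_left _ hN3
  have hK : 2 ^ (D.width + 1) = 2 * X := by rw [pow_succ, mul_comm]
  have hKt : 2 ^ (D.width + 1) * t ≤ 2 * (X * N) := by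
    rw [hK, mul_assoc]; gcongr
  have htn : t * n ≤ N ^ 2 := by rw [pow_two]; gcongr
  have htt : t * t ≤ N ^ 2 := by rw [pow_two]; gcongr
  -- Every monomial is at most `X * N ^ 3`, and the coefficients add up to 1193.
  have hbound : (N * (2 * X * 19 + N * 19 + 30) + 6) +
      ((N * (N * 26 + N * 57 + 2 * X * 40 + 68) + 6) +
        ((N * (N * (2 * X * (N * 140 + 120) + N * 38 + N * 30 + 128) + 14) + 6) +
          (N * (2 * X * 24 + N * 19 + 40) + 20))) ≤ 2000 * (X * N ^ 3) := by
    linarith only [hN1, hN2, hN3, hNX, hXN, hXN2]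
  rw [mul_assoc] at hw ⊢
  have hirr : ∀ x, ¬ TutteRAM.natAdj D.tree x x := by
    rintro x ⟨_, _, h⟩
    exact D.tree.irrefl h
  let E := D.toBagData w ht (by omega) (by omega) (by omega) (by omega) (by omega) (by omega)
  have hT : E.isingTime ≤ 2000 * (X * N ^ 3) := by
    calc E.isingTime
        = (t * (2 * X * 19 + n * 19 + 30) + 6) +
          ((m * (t * 26 + n * 57 + 2 * X * 40 + 68) + 6) +
            ((t * (t * (2 * X * (n * 140 + 120) + n * 38 + t * 30 + 128) + 14) + 6) +
              (t * (2 * X * 24 + n * 19 + 40) + 20))) := by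
          rw [← hK]; rfl
      _ ≤ (N * (2 * X * 19 + N * 19 + 30) + 6) +
          ((N * (N * 26 + N * 57 + 2 * X * 40 + 68) + 6) +
            ((N * (N * (2 * X * (N * 140 + 120) + N * 38 + N * 30 + 128) + 14) + 6) +
              (N * (2 * X * 24 + N * 19 + 40) + 20))) := by gcongr
      _ ≤ 2000 * (X * N ^ 3) := hbound
  obtain ⟨T, s, hexec, hTs, hs⟩ := TutteRAM.BagData.runs_tutte (E := E)
    (D.input_toBagData a b) (a := a) (b := b) (k := G.numComp Finset.univ) (Z := G.ising b 1)
    (by simp [TutteRAM.input]) (by simp [TutteRAM.input]) ha1 hb1 (G.numComp_le _)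
    hirr
    ((D.sum_weight 1 0).trans G.ising_one_zero) (D.sum_weight b 1)
  refine ⟨T, s, hexec, hTs.trans ?_, ?_⟩
  · have : E.n = n := rfl
    omega
  · rw [← G.tutte_mul hab'] at hs
    exact mul_right_cancel₀ (mul_ne_zero (pow_ne_zero _ ha1) (pow_ne_zero _ hb1)) hs
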